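/- Let $n\ge 2$. Let $\mathrm{UConf}_n(\mathbb C)$ be the space of unordered $n$-tuples of distinct points of $\mathbb C$ (the quotient of $\{z\in\mathbb C^n : z_i\ne z_j \text{ for } i\neq j\}$ by the symmetric group, equivalently the space of monic complex polynomials of degree $n$ with simple roots), and let $A^n=\mathrm{UConf}_n(\mathbb R)$ be the subset of configurations of $n$ distinct real points. Let $D_{4n}=\langle \mathfrak s,\mathfrak t\rangle$ be the dihedral group of homeomorphisms of $\mathrm{UConf}_n(\mathbb C)$ generated by the rotation $\mathfrak s:P(z)\mapsto iP(e^{-i\pi/2n}z)$ (multiplication of all points by $e^{i\pi/2n}$) and the reflection $\mathfrak t:P(z)\mapsto\overline{P(\overline z)}$ (complex conjugation of all points). A chamber is a nonempty connected open set $C\subseteq \mathrm{UConf}_n(\mathbb C)$ whose translates $gC$, $g\in D_{4n}$, are pairwise disjoint (for distinct $g$) and such that $\bigcup_{g\in D_{4n}}\overline{gC}=\mathrm{UConf}_n(\mathbb C)$. For a space $X$ and $B\subseteq X$, let $\Pi_1(X,B)$ be the full subgroupoid of the fundamental groupoid of $X$ on the objects $B$. There is a chamber $C$ with $A^n\subseteq\overline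 C$ such that, with $X_2=\bigcup_{g\in D_{4n},\,g\ne 1}\overline{gC}$ the union of the other closed chambers, every open neighbourhood $N$ of the closed chamber $\overline C$ contains a subspace $X_1$ with the following properties: * $X_1$ is a thickening of the closed chamber $\overline C$, that is, an open set containing $\overline C$ of which $\overline C$ is a strong deformation retract; * $X_0=X_1\cap X_2$ contains $A^n$, and is nonempty; * the interiors of $X_1$ and $X_2$ cover $\mathrm{UConf}_n(\mathbb C)$; * for every set of base points $B\subseteq A^n$ that meets every path component of $A^n$ (for instance $B=A^n$, or one point in each path component of $A^n$), the canonical morphism of groupoids $$\Pi_1(X_1,B)\star_{\Pi_1(X_0,B)}\Pi_1(X_2,B)\longrightarrow \Pi_1(\mathrm{UConf}_n(\mathbb C),B)$$ is an isomorphism, where $\star$ is the free product with amalgamation, i.e. the pushout in the category of groupoids. -/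

import Mathlib

open CategoryTheory

/-- The configuration space of `n` labelled distinct points of `ℂ`, a subspace of `ℂⁿ`. -/
abbrev OConf (n : ℕ) : Type := {z : Fin n → ℂ // Function.Injective z}

/-- Two labelled configurations are identified when they differ by a relabelling. -/
def OConf.setoid (n : ℕ) : Setoid (OConf n) where
  r z w := ∃ σ : Equiv.Perm (Fin n), ∀ i, w.1 i = z.1 (σ i)
  iseqv :=
    { refl := fun _ => ⟨1, fun _ => rfl⟩
      symm := fun {z w} ⟨σ, h⟩ => ⟨σ⁻¹, fun i => by rw [h]; simp⟩
      trans := fun {x y z} ⟨σ, h⟩ ⟨τ, k⟩ => ⟨σ * τ, fun i => by rw [k, h]; simp⟩ }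

/-- The configuration space `UConf_n(ℂ)` of `n` unordered distinct points of `ℂ`: the quotient of
the labelled configuration space by the symmetric group. -/
def UConf (n : ℕ) : Type := Quotient (OConf.setoid n)

namespace UConf

variable {n : ℕ}

/-- The quotient topology. -/
instance : TopologicalSpace (UConf n) :=
  inferInstanceAs (TopologicalSpace (Quotient (OConf.setoid n)))

/-- The unordered configuration underlying a labelled one. -/
def mk (z : OConf n) : UConf n := Quotient.mk (OConf.setoid n) z

/-- Apply a self-homeomorphism of `ℂ` to each point of a configuration. -/
noncomputable def mapFun (φ : ℂ ≃ₜ ℂ) : UConf n → UConf n :=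
  Quotient.map (sa := OConf.setoid n) (sb := OConf.setoid n)
    (fun z => ⟨fun i => φ (z.1 i), φ.injective.comp z.2⟩)
    (fun _ _ ⟨σ, h⟩ => ⟨σ, fun i => congrArg φ (h i)⟩)

theorem continuous_mapFun (φ : ℂ ≃ₜ ℂ) : Continuous (mapFun φ : UConf n → UConf n) := by
  refine continuous_quot_lift _ ?_
  refine continuous_quot_mk.comp (Continuous.subtype_mk ?_ _)
  exact continuous_pi fun i =>
    φ.continuous.comp ((continuous_apply i).comp continuous_subtype_val)

/-- The self-homeomorphism of `UConf_n(ℂ)` induced by one of `ℂ`. -/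
noncomputable def mapHomeo (φ : ℂ ≃ₜ ℂ) : UConf n ≃ₜ UConf n where
  toFun := mapFun φ
  invFun := mapFun φ.symm
  left_inv := by
    rintro ⟨z⟩
    refine congrArg (Quotient.mk (OConf.setoid n)) (Subtype.ext (funext fun i => ?_))
    exact φ.symm_apply_apply (z.1 i)
  right_inv := by
    rintro ⟨z⟩
    refine congrArg (Quotient.mk (OConf.setoid n)) (Subtype.ext (funext fun i => ?_))
    exact φ.apply_symm_apply (z.1 i)
  continuous_toFun := continuous_mapFun φ
  continuous_invFun := continuous_mapFun φ.symm

/-- The rotation `𝔰`. A configuration corresponds to the monic polynomial `P` with these roots,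
and `𝔰` sends `P` to `i P(e^{-iπ/2n} z)`, whose roots are those of `P` multiplied by
`e^{iπ/2n}`. -/
noncomputable def rotation (n : ℕ) : UConf n ≃ₜ UConf n :=
  mapHomeo (Homeomorph.mulLeft₀ (Complex.exp (Real.pi * Complex.I / (2 * n)))
    (Complex.exp_ne_zero _))

/-- The reflection `𝔱`. On monic polynomials it sends `P` to the polynomial whose value at `z` is
the conjugate of `P (conj z)`; it conjugates the roots. -/
noncomputable def reflection (n : ℕ) : UConf n ≃ₜ UConf n :=
  mapHomeo Complex.conjLIE.toHomeomorph

/-- The dihedral group `D_{4n} = ⟨𝔰, 𝔱⟩` of transformations of `UConf_n(ℂ)`. -/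
noncomputable def dihedral (n : ℕ) : Subgroup (UConf n ≃ₜ UConf n) :=
  Subgroup.closure {rotation n, reflection n}

/-- `UConf_n(ℝ)`: the configurations all of whose points are real. -/
def realPoints (n : ℕ) : Set (UConf n) :=
  {x | ∃ z : OConf n, (∀ i, (z.1 i).im = 0) ∧ mk z = x}

end UConf

/-- `C` is a chamber for the group `G` of homeomorphisms of `X`: a nonempty connected open set
whose translates under distinct elements of `G` are disjoint, and such that the translates of its
closure cover `X`. -/
structure IsChamber {X : Type} [TopologicalSpace X] (G : Subgroup (X ≃ₜ X)) (C : Set X) :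
    Prop where
  isOpen : IsOpen C
  isConnected : IsConnected C
  disjoint : ∀ g ∈ G, ∀ h ∈ G, g ≠ h → Disjoint (g '' C) (h '' C)
  cover : ⋃ g ∈ G, closure (g '' C) = Set.univ

/-- The union of the closed chambers `g C̄`, `g ≠ 1`, other than `C̄`. -/
def otherChambers {X : Type} [TopologicalSpace X] (G : Subgroup (X ≃ₜ X)) (C : Set X) : Set X :=
  ⋃ g ∈ G, ⋃ _ : g ≠ 1, closure (g '' C)

/-- `U` is a thickening of `F`: an open set containing `F`, of which `F` is a strong deformation
retract. -/
structure IsThickening {X : Type} [TopologicalSpace X] (F U : Set X) : Prop where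
  isOpen : IsOpen U
  subset : F ⊆ U
  retract : ∃ H : C(unitInterval × U, U),
    (∀ x : U, H (0, x) = x) ∧ (∀ x : U, (H (1, x) : X) ∈ F) ∧
      ∀ (t : unitInterval) (x : U), (x : X) ∈ F → H (t, x) = x

/-- The fundamental groupoid `Π₁(X, B)` of `X` on a set `B` of base points: the full subgroupoid
of the fundamental groupoid of `X` whose objects are the points of `B`. -/
abbrev Pi1 (X : Type) [TopologicalSpace X] (B : Set X) : Type :=
  InducedCategory (FundamentalGroupoid X) (fun b : B => FundamentalGroupoid.mk (b : X))

/-- The pushforward functor `Π₁(X, B) ⥤ Π₁(Y, B')` of a continuous map sending `B` into `B'`. -/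
noncomputable def Pi1.map {X Y : Type} [TopologicalSpace X] [TopologicalSpace Y] {B : Set X} {B' : Set Y}
    (f : C(X, Y)) (hf : Set.MapsTo f B B') : Pi1 X B ⥤ Pi1 Y B' where
  obj b := (⟨f b.1, hf b.2⟩ : B')
  map p := InducedCategory.homMk ((FundamentalGroupoid.map f).map p.hom)
  map_id _ := InducedCategory.hom_ext ((FundamentalGroupoid.map f).map_id _)
  map_comp p q := InducedCategory.hom_ext ((FundamentalGroupoid.map f).map_comp p.hom q.hom)

/-- `Π₁(U, B ∩ U)` for a subspace `U` of `X`, as an object of the category of groupoids. -/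
noncomputable abbrev pi1Sub {X : Type} [TopologicalSpace X] (U B : Set X) : Grpd.{0, 0} :=
  Grpd.of (Pi1 U {u : U | (u : X) ∈ B})

/-- The morphism `Π₁(U, B ∩ U) ⟶ Π₁(V, B ∩ V)` induced by an inclusion `U ⊆ V`. -/
noncomputable def pi1Incl {X : Type} [TopologicalSpace X] {U V : Set X} (h : U ⊆ V) (B : Set X) :
    pi1Sub U B ⟶ pi1Sub V B :=
  Pi1.map (ContinuousMap.inclusion h) fun _ hu => hu

/-- The morphism `Π₁(U, B ∩ U) ⟶ Π₁(X, B)` induced by the inclusion of `U` in `X`. -/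
noncomputable def pi1InclTop {X : Type} [TopologicalSpace X] (U B : Set X) :
    pi1Sub U B ⟶ Grpd.of (Pi1 X B) :=
  Pi1.map (⟨Subtype.val, continuous_subtype_val⟩ : C(U, X)) fun _ hu => hu

/-- The canonical morphism `Π₁(X₁, B) ⋆_{Π₁(X₀, B)} Π₁(X₂, B) ⟶ Π₁(X, B)`, with
`X₀ = X₁ ∩ X₂`, is an isomorphism. As the amalgamated free product of groupoids is their pushout,
this says that `Π₁(X, B)` with the two morphisms induced by inclusions is a pushout. -/
def VanKampenIso {X : Type} [TopologicalSpace X] (X₁ X₂ B : Set X) : Prop :=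
  IsPushout (pi1Incl (Set.inter_subset_left : X₁ ∩ X₂ ⊆ X₁) B)
    (pi1Incl (Set.inter_subset_right : X₁ ∩ X₂ ⊆ X₂) B)
    (pi1InclTop X₁ B) (pi1InclTop X₂ B)

/-! The proof combines a van Kampen theorem for path connected pieces with an explicit chamber cut
out by second moments.

Van Kampen (`vanKampenIso`). A `PathRep` plays the role of a flat connection: it assigns group
elements to paths, multiplicatively and up to homotopy. Compatible representations on a cover by
interiors glue. Pulled back along a path or a homotopy, they have a primitive on the unit interval
or square, because primitives exist on small cells by convexity and can be matched across
hyperplanes, being unique up to a right factor. The transport along a path is the quotient of the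
end values of a primitive, and the square gives homotopy invariance. A functor on the groupoid
reduces to such a representation in the vertex group of one base point, once every point is joined
to that base point inside each piece containing it; this is where path connectedness of both pieces
and of their intersection enters.

The chamber. Let m be the centre of mass and q the sum of the squares (z_i - m)². Rotation by π/2n
multiplies q by e^{iπ/n} and conjugation conjugates q, so the group acts on the q-plane as a
dihedral group whose sectors have angle π/2n. What acts trivially on q is only rotation by 0 or π,
and rotation by π changes the sign of Im m. The open chamber is therefore 0 < arg q < π/2n, Im m >
0, and the union of the other closed chambers is its complement (`otherChambers_chamber`).

The thickening. With X, Y the centred real and imaginary parts, Re q = ΣX² - ΣY² and Im q = 2ΣXY. On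
the closed chamber ΣX² > 0. Where ΣX² > 0, horizontal stretches, shears and vertical translations
allow `width`, `tilt` and `height` to be prescribed freely while `thick` stays fixed. The closed
chamber is then given by lower bounds on `tilt`, `width` and `height`, and raising these linearly to
their bounds is a strong deformation retraction (`slide`). Points whose whole track stays in N form
the thickening. Tracks starting outside the open chamber never enter it, so the intersection with
the complement retracts to the boundary.

Connectedness. Closed chamber, boundary and complement of the open chamber are each joined to the
connected set of real configurations: translate to height zero, make real parts distinct by a small
shear, and flatten the imaginary parts. In the first two cases a preliminary stretch gives room for
the shear. -/

/-! ### Group-valued representations of paths -/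

section VanKampenCore

open unitInterval Set Topology

/-- A homotopy invariant multiplicative function on the paths of `Y`, with values in a group. The
order of the factors is that of transport operators. -/
structure PathRep (Y H : Type*) [TopologicalSpace Y] [Group H] where
  toFun : C(I, Y) → H
  map_trans : ∀ {x y z : Y} (p : Path x y) (q : Path y z),
    toFun (p.trans q : C(I, Y)) = toFun q * toFun p
  map_homotopic : ∀ {x y : Y} (p q : Path x y), p.Homotopic q → toFun (p : C(I, Y)) = toFun q

namespace PathRep

variable {Y Z H H' : Type*} [TopologicalSpace Y] [TopologicalSpace Z] [Group H] [Group H']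

instance : CoeFun (PathRep Y H) (fun _ => C(I, Y) → H) := ⟨toFun⟩

@[ext]
theorem ext {φ ψ : PathRep Y H} (h : ∀ γ, φ γ = ψ γ) : φ = ψ := by
  cases φ; cases ψ; congr; exact funext h

/-- A constant path is its own concatenation square, so its value is an idempotent of a group. -/
theorem map_refl (φ : PathRep Y H) (y : Y) : φ (Path.refl y : C(I, Y)) = 1 := by
  have h := φ.map_trans (Path.refl y) (Path.refl y)
  rw [Path.refl_trans_refl] at h
  exact (left_eq_mul.1 h)

theorem map_const (φ : PathRep Y H) (y : Y) : φ (ContinuousMap.const I y) = 1 :=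
  φ.map_refl y

/-- Pull back along a continuous map. -/
def comap (φ : PathRep Y H) (f : C(Z, Y)) : PathRep Z H where
  toFun γ := φ (f.comp γ)
  map_trans {x y z} p q := by
    have h := φ.map_trans (p.map f.continuous) (q.map f.continuous)
    rw [← Path.map_trans] at h
    exact h
  map_homotopic p q h := φ.map_homotopic _ _ (h.map f)

/-- Push forward along a group homomorphism. -/
def mapHom (φ : PathRep Y H) (f : H →* H') : PathRep Y H' where
  toFun γ := f (φ γ)
  map_trans p q := by rw [φ.map_trans, map_mul]
  map_homotopic p q h := by rw [φ.map_homotopic p q h]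

/-- The function induced on homotopy classes. -/
def onClass (φ : PathRep Y H) {x y : Y} : Path.Homotopic.Quotient x y → H :=
  Quotient.lift (fun p : Path x y => φ (p : C(I, Y))) fun p q h => φ.map_homotopic p q h

theorem onClass_mk (φ : PathRep Y H) {x y : Y} (p : Path x y) :
    φ.onClass (Path.Homotopic.Quotient.mk p) = φ (p : C(I, Y)) := rfl

theorem onClass_trans (φ : PathRep Y H) {x y z : Y} (p : Path.Homotopic.Quotient x y)
    (q : Path.Homotopic.Quotient y z) :
    φ.onClass (p.trans q) = φ.onClass q * φ.onClass p := by
  induction p with | mk p => induction q with | mk q => exact φ.map_trans p q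

theorem onClass_refl (φ : PathRep Y H) (y : Y) :
    φ.onClass (Path.Homotopic.Quotient.refl y) = 1 :=
  φ.map_refl y

end PathRep

/-- The straight path from `v` to `w`. -/
noncomputable def segPath {E : Type*} [AddCommGroup E] [Module ℝ E] [TopologicalSpace E]
    [IsTopologicalAddGroup E] [ContinuousSMul ℝ E] (v w : E) : C(I, E) where
  toFun t := AffineMap.lineMap v w (t : ℝ)
  continuous_toFun := by
    simp only [AffineMap.lineMap_apply_module]
    fun_prop

section Triangle

variable {E H : Type*} [AddCommGroup E] [Module ℝ E] [TopologicalSpace E]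
    [IsTopologicalAddGroup E] [ContinuousSMul ℝ E] [Group H]

theorem segPath_apply (v w : E) (t : I) :
    segPath v w t = AffineMap.lineMap v w (t : ℝ) := rfl

theorem segPath_zero_one (t : I) : segPath (0 : ℝ) 1 t = t := by
  simp [segPath_apply, AffineMap.lineMap_apply_module]

theorem segPath_mem {A : Set E} (hA : Convex ℝ A) {v w : E} (hv : v ∈ A) (hw : w ∈ A) (t : I) :
    segPath v w t ∈ A :=
  hA.lineMap_mem hv hw t.2

/-- The straight path in a convex set. -/
noncomputable def segPathIn {A : Set E} (hA : Convex ℝ A) {v w : E} (hv : v ∈ A) (hw : w ∈ A) :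
    Path (⟨v, hv⟩ : A) ⟨w, hw⟩ where
  toFun t := ⟨segPath v w t, segPath_mem hA hv hw t⟩
  continuous_toFun := by fun_prop
  source' := Subtype.ext (by simp [segPath_apply])
  target' := Subtype.ext (by simp [segPath_apply])

/-- A convex set is contractible, so the two ways from `u` to `w` are homotopic. -/
theorem PathRep.triangle {A : Set E} (hA : Convex ℝ A) (φ : PathRep A H) {u v w : E} (hu : u ∈ A)
    (hv : v ∈ A) (hw : w ∈ A) :
    φ (segPathIn hA hu hw : C(I, A)) =
      φ (segPathIn hA hv hw : C(I, A)) * φ (segPathIn hA hu hv : C(I, A)) := by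
  rw [← φ.map_trans]
  refine φ.map_homotopic _ _ ?_
  have : ContractibleSpace A := hA.contractibleSpace ⟨u, hu⟩
  exact SimplyConnectedSpace.paths_homotopic _ _

end Triangle

/-! ### Primitives of local representations, and gluing -/

section Primitive

variable {X H ι : Type*} [TopologicalSpace X] [Group H] {S : ι → Set X}

/-- Local representations on the members of a cover agree on common paths. -/
def PathRep.Compatible (φ : ∀ i, PathRep (S i) H) : Prop :=
  ∀ i j (γ : C(I, X)) (hi : ∀ t, γ t ∈ S i) (hj : ∀ t, γ t ∈ S j),
    φ i ⟨fun t => ⟨γ t, hi t⟩, by fun_prop⟩ = φ j ⟨fun t => ⟨γ t, hj t⟩, by fun_prop⟩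

variable {E E' : Type*} [NormedAddCommGroup E] [NormedSpace ℝ E]
  [NormedAddCommGroup E'] [NormedSpace ℝ E']

/-- `T` is a primitive on `A` of the pullback along `K` of the local representations `φ i`. -/
def IsPrimitive (φ : ∀ i, PathRep (S i) H) (K : C(E, X)) (A : Set E) (T : E → H) : Prop :=
  ∀ i v w, v ∈ A → w ∈ A → ∀ h : ∀ t, K (segPath v w t) ∈ S i,
    T w = φ i ⟨fun t => ⟨K (segPath v w t), h t⟩, by fun_prop⟩ * T v

variable {φ : ∀ i, PathRep (S i) H} {K : C(E, X)} {A A' B : Set E} {T T' : E → H}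

theorem IsPrimitive.mono (hT : IsPrimitive φ K A T) (h : B ⊆ A) : IsPrimitive φ K B T :=
  fun i v w hv hw => hT i v w (h hv) (h hw)

theorem IsPrimitive.mul_right (hT : IsPrimitive φ K A T) (g : H) :
    IsPrimitive φ K A fun v => T v * g := fun i v w hv hw h => by
  simp only [hT i v w hv hw h, mul_assoc]

theorem IsPrimitive.congr (hT : IsPrimitive φ K A T) (h : ∀ v ∈ A, T' v = T v) :
    IsPrimitive φ K A T' := fun i v w hv hw hh => by
  rw [h v hv, h w hw, hT i v w hv hw hh]

/-- `L` need only carry straight segments to straight segments. This serves to restrict a primitive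
to half of a path or to a side of the square. -/
theorem IsPrimitive.pullback (hT : IsPrimitive φ K A T) (L : E' → E)
    (hL : ∀ v w t, L (segPath v w t) = segPath (L v) (L w) t) {K' : C(E', X)} {D : Set E'}
    (hD : Convex ℝ D) (hDA : MapsTo L D A) (hK : ∀ v ∈ D, K' v = K (L v)) :
    IsPrimitive φ K' D (T ∘ L) := by
  intro i v w hv hw h
  have key : ∀ t, K' (segPath v w t) = K (segPath (L v) (L w) t) := fun t => by
    rw [hK _ (segPath_mem hD hv hw t), hL]
  have h' : ∀ t, K (segPath (L v) (L w) t) ∈ S i := fun t => key t ▸ h t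
  simp only [Function.comp_apply]
  rw [hT i (L v) (L w) (hDA hv) (hDA hw) h']
  congr 2
  ext t
  exact (key t).symm

/-- Integrate from a fixed point `u` along straight segments; the triangle identity gives the
primitive property for the index `i`, and compatibility transfers it to every other index. -/
theorem exists_isPrimitive_of_mapsTo (hφ : PathRep.Compatible φ) (hA : Convex ℝ A) (i : ι)
    (hK : ∀ v ∈ A, K v ∈ S i) : ∃ T, IsPrimitive φ K A T := by
  classical
  rcases A.eq_empty_or_nonempty with rfl | ⟨u, hu⟩
  · exact ⟨fun _ => 1, fun _ _ _ hv => hv.elim⟩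
  let ψ : PathRep A H := (φ i).comap ⟨fun v => ⟨K v, hK v v.2⟩, by fun_prop⟩
  refine ⟨fun w => if hw : w ∈ A then ψ (segPathIn hA hu hw : C(I, A)) else 1, ?_⟩
  intro j v w hv hw h
  simp only [hv, hw, dif_pos]
  rw [ψ.triangle hA hu hv hw]
  congr 1
  exact hφ i j ⟨fun t => K (segPath v w t), by fun_prop⟩
    (fun t => hK _ (segPath_mem hA hv hw t)) h

/-- Two primitives on a convex set differ by a constant. -/
theorem IsPrimitive.unique (hS : ∀ x, ∃ i, x ∈ interior (S i)) (hA : Convex ℝ A)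
    (hT : IsPrimitive φ K A T) (hT' : IsPrimitive φ K A T') {v w : E} (hv : v ∈ A) (hw : w ∈ A) :
    (T v)⁻¹ * T' v = (T w)⁻¹ * T' w := by
  -- With the discrete topology on `H`, continuity means local constancy, and a locally constant
  -- function on a connected set is constant.
  let _ : TopologicalSpace H := ⊥
  have : DiscreteTopology H := ⟨rfl⟩
  refine hA.isPreconnected.constant (f := fun v => (T v)⁻¹ * T' v) ?_ hv hw
  intro u hu
  obtain ⟨i, hi⟩ := hS (K u)
  have hn : K ⁻¹' interior (S i) ∈ 𝓝 u := K.continuous.continuousAt (isOpen_interior.mem_nhds hi)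
  obtain ⟨r, hr, hb⟩ := Metric.mem_nhds_iff.1 hn
  refine ContinuousWithinAt.congr_of_eventuallyEq (f := fun _ => (T u)⁻¹ * T' u)
    continuousWithinAt_const ?_ rfl
  filter_upwards [self_mem_nhdsWithin, mem_nhdsWithin_of_mem_nhds (Metric.ball_mem_nhds u hr)]
    with x hx hxb
  have hseg : ∀ t, K (segPath u x t) ∈ S i := fun t =>
    interior_subset (hb (segPath_mem (convex_ball u r) (Metric.mem_ball_self hr) hxb t))
  rw [hT i u x hu hx hseg, hT' i u x hu hx hseg]
  group

theorem segPath_cross (f : E →ₗ[ℝ] ℝ) {c : ℝ} {v w : E} (hv : f v ≤ c) (hw : c ≤ f w) :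
    ∃ t ∈ I, f (AffineMap.lineMap v w t) = c := by
  rcases hv.eq_or_lt with h | h
  · exact ⟨0, by simp, by simpa using h⟩
  · have hd : 0 < f w - f v := by linarith
    refine ⟨(c - f v) / (f w - f v), ⟨by apply div_nonneg <;> linarith, ?_⟩, ?_⟩
    · rw [div_le_one hd]; linarith
    · simp only [AffineMap.lineMap_apply_module', map_add, map_smul, map_sub, smul_eq_mul]
      field_simp
      ring

theorem segPath_subseg (v w : E) (a b : ℝ) (t : I) :
    segPath (AffineMap.lineMap v w a : E) (AffineMap.lineMap v w b) t =
      AffineMap.lineMap v w (AffineMap.lineMap a b (t : ℝ)) := by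
  simp only [segPath_apply, AffineMap.lineMap_apply_module', smul_eq_mul]
  module

/-- A function with the primitive property on short segments `v u`, `u w` has it on `v w`. -/
theorem IsPrimitive.of_cross {i : ι} {v u w : E} {s : ℝ} (hs : s ∈ I)
    (hu : AffineMap.lineMap v w s = u) (h : ∀ t, K (segPath v w t) ∈ S i) :
    ∃ (h₁ : ∀ t, K (segPath v u t) ∈ S i) (h₂ : ∀ t, K (segPath u w t) ∈ S i),
      φ i ⟨fun t => ⟨K (segPath v w t), h t⟩, by fun_prop⟩ =
        φ i ⟨fun t => ⟨K (segPath u w t), h₂ t⟩, by fun_prop⟩ *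
          φ i ⟨fun t => ⟨K (segPath v u t), h₁ t⟩, by fun_prop⟩ := by
  have e : ∀ t : I, AffineMap.lineMap v w (t : ℝ) = segPath v w t := fun _ => rfl
  have hconv : Convex ℝ (I : Set ℝ) := convex_Icc 0 1
  have h0 : (0 : ℝ) ∈ I := zero_mem
  have h1 : (1 : ℝ) ∈ I := one_mem
  have e₁ : ∀ t, segPath v u t = segPath v w ⟨segPath 0 s t, segPath_mem hconv h0 hs t⟩ := by
    intro t
    have := segPath_subseg v w 0 s t
    rw [AffineMap.lineMap_apply_zero, hu] at this
    exact this
  have e₂ : ∀ t, segPath u w t = segPath v w ⟨segPath s 1 t, segPath_mem hconv hs h1 t⟩ := by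
    intro t
    have := segPath_subseg v w s 1 t
    rw [AffineMap.lineMap_apply_one, hu] at this
    exact this
  refine ⟨fun t => e₁ t ▸ h _, fun t => e₂ t ▸ h _, ?_⟩
  let ψ : PathRep I H := (φ i).comap ⟨fun t => ⟨K (segPath v w t), h t⟩, by fun_prop⟩
  have ht := ψ.triangle hconv h0 hs h1
  have a0 : ψ (segPathIn hconv h0 h1 : C(I, I)) =
      φ i ⟨fun t => ⟨K (segPath v w t), h t⟩, by fun_prop⟩ := by
    change φ i _ = φ i _
    congr 1
    ext t
    change K (segPath v w ⟨segPath (0 : ℝ) 1 t, _⟩) = K (segPath v w t)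
    congr 2
    exact Subtype.ext (segPath_zero_one t)
  rw [← a0, ht]
  congr 1
  · change φ i _ = φ i _
    congr 1
    ext t
    exact congrArg K (e₂ t).symm
  · change φ i _ = φ i _
    congr 1
    ext t
    exact congrArg K (e₁ t).symm

/-- A segment with ends on different sides is cut where it meets the hyperplane; the cut point
belongs to both closed sides. -/
theorem IsPrimitive.glue_aux (f : E →ₗ[ℝ] ℝ) (c : ℝ) (hB : Convex ℝ B)
    (h₁ : IsPrimitive φ K (B ∩ {v | f v ≤ c}) T) (h₂ : IsPrimitive φ K (B ∩ {v | c ≤ f v}) T) :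
    IsPrimitive φ K B T := by
  intro i v w hv hw h
  rcases le_total (f v) c with hvc | hvc <;> rcases le_total (f w) c with hwc | hwc
  · exact h₁ i v w ⟨hv, hvc⟩ ⟨hw, hwc⟩ h
  · obtain ⟨s, hs, hsc⟩ := segPath_cross f hvc hwc
    have hu := hB.lineMap_mem hv hw hs
    obtain ⟨k₁, k₂, hk⟩ := IsPrimitive.of_cross (φ := φ) (K := K) hs rfl h
    rw [hk, mul_assoc, ← h₁ i v _ ⟨hv, hvc⟩ ⟨hu, hsc.le⟩ k₁, ← h₂ i _ w ⟨hu, hsc.ge⟩ ⟨hw, hwc⟩ k₂]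
  · obtain ⟨s, hs, hsc⟩ := segPath_cross (-f) (c := -c) (v := v) (w := w)
      (by simpa using hvc) (by simpa using hwc)
    have hsc' : f (AffineMap.lineMap v w s) = c := by simpa using hsc
    have hu := hB.lineMap_mem hv hw hs
    obtain ⟨k₁, k₂, hk⟩ := IsPrimitive.of_cross (φ := φ) (K := K) hs rfl h
    rw [hk, mul_assoc, ← h₂ i v _ ⟨hv, hvc⟩ ⟨hu, hsc'.ge⟩ k₁,
      ← h₁ i _ w ⟨hu, hsc'.le⟩ ⟨hw, hwc⟩ k₂]
  · exact h₂ i v w ⟨hv, hvc⟩ ⟨hw, hwc⟩ h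

/-- Primitives exist on a convex set if they exist on both sides of a hyperplane. -/
theorem exists_isPrimitive_glue (hS : ∀ x, ∃ i, x ∈ interior (S i)) (f : E →ₗ[ℝ] ℝ) (c : ℝ)
    (hB : Convex ℝ B) (h₁ : ∃ T, IsPrimitive φ K (B ∩ {v | f v ≤ c}) T)
    (h₂ : ∃ T, IsPrimitive φ K (B ∩ {v | c ≤ f v}) T) : ∃ T, IsPrimitive φ K B T := by
  classical
  obtain ⟨T₁, h₁⟩ := h₁
  obtain ⟨T₂, h₂⟩ := h₂
  have hD : Convex ℝ (B ∩ {v | f v = c}) := hB.inter (convex_hyperplane f.isLinear c)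
  -- The two primitives differ by a right factor `g` on the convex slice where they overlap. If the
  -- slice is empty, any `g` will do.
  obtain ⟨g, hg⟩ : ∃ g, ∀ v ∈ B ∩ {v | f v = c}, T₂ v * g = T₁ v := by
    rcases (B ∩ {v | f v = c}).eq_empty_or_nonempty with he | ⟨u, hu⟩
    · exact ⟨1, fun v hv => by simp [he] at hv⟩
    · refine ⟨(T₂ u)⁻¹ * T₁ u, fun v hv => ?_⟩
      rw [← IsPrimitive.unique hS hD (h₂.mono fun x hx => ⟨hx.1, hx.2.ge⟩)
        (h₁.mono fun x hx => ⟨hx.1, hx.2.le⟩) hv hu]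
      group
  refine ⟨fun v => if f v ≤ c then T₁ v else T₂ v * g, IsPrimitive.glue_aux f c hB ?_ ?_⟩
  · exact h₁.congr fun v hv => if_pos hv.2
  · refine (h₂.mul_right g).congr fun v hv => ?_
    by_cases hvc : f v ≤ c
    · simp only [hvc, if_true]
      exact (hg v ⟨hv.1, le_antisymm hvc hv.2⟩).symm
    · simp only [hvc, if_false]

/-- Primitives exist on the unit square. -/
theorem exists_isPrimitive_square (hS : ∀ x, ∃ i, x ∈ interior (S i))
    (hφ : PathRep.Compatible φ) (K : C(ℝ × ℝ, X)) :
    ∃ T, IsPrimitive φ K (Icc 0 1 ×ˢ Icc 0 1) T := by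
  obtain ⟨δ, hδ, hleb⟩ := lebesgue_number_lemma_of_metric
    (s := (Icc (0 : ℝ) 1 ×ˢ Icc (0 : ℝ) 1)) (c := fun i => K ⁻¹' interior (S i))
    (isCompact_Icc.prod isCompact_Icc) (fun i => isOpen_interior.preimage K.continuous)
    (fun v _ => mem_iUnion.2 (hS (K v)))
  obtain ⟨N, hN⟩ := exists_nat_one_div_lt hδ
  set e : ℝ := 1 / ((N : ℝ) + 1) with he
  have hN0 : (0 : ℝ) < (N : ℝ) + 1 := by positivity
  have he0 : 0 < e := by positivity
  have hle : ∀ k : ℕ, k ≤ N + 1 → (k : ℝ) * e ≤ 1 := fun k hk => by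
    rw [he, mul_one_div, div_le_one hN0]; exact_mod_cast hk
  have hsq : ∀ a b : ℕ, a + 1 ≤ N + 1 → b + 1 ≤ N + 1 →
      ∃ T, IsPrimitive φ K (Icc (a * e) ((a + 1 : ℕ) * e) ×ˢ Icc (b * e) ((b + 1 : ℕ) * e)) T := by
    intro a b ha hb
    -- The product metric is the maximum metric, so a cell of side `e < δ` lies in the `δ`-ball
    -- about its lower left corner, hence in one member of the cover.
    obtain ⟨i, hi⟩ := hleb (a * e, b * e)
      ⟨⟨by positivity, hle a (by omega)⟩, ⟨by positivity, hle b (by omega)⟩⟩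
    refine exists_isPrimitive_of_mapsTo hφ ((convex_Icc _ _).prod (convex_Icc _ _)) i ?_
    rintro ⟨x, y⟩ ⟨⟨hx1, hx2⟩, ⟨hy1, hy2⟩⟩
    refine interior_subset (hi ?_)
    push_cast at hx1 hx2 hy1 hy2
    rw [Metric.mem_ball, Prod.dist_eq, max_lt_iff, Real.dist_eq, Real.dist_eq, abs_lt, abs_lt]
    dsimp only
    refine ⟨⟨?_, ?_⟩, ⟨?_, ?_⟩⟩ <;> nlinarith
  have hcol : ∀ a : ℕ, a + 1 ≤ N + 1 → ∀ b : ℕ, b + 1 ≤ N + 1 →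
      ∃ T, IsPrimitive φ K (Icc (a * e) ((a + 1 : ℕ) * e) ×ˢ Icc 0 ((b + 1 : ℕ) * e)) T := by
    intro a ha b
    induction b with
    | zero => intro hb; simpa using hsq a 0 ha hb
    | succ b ih =>
      intro hb
      refine exists_isPrimitive_glue hS (LinearMap.snd ℝ ℝ ℝ) ((b + 1 : ℕ) * e)
        ((convex_Icc _ _).prod (convex_Icc _ _)) ?_ ?_
      · obtain ⟨T, hT⟩ := ih (by omega)
        exact ⟨T, hT.mono fun v hv => ⟨hv.1.1, hv.1.2.1, hv.2⟩⟩
      · obtain ⟨T, hT⟩ := hsq a (b + 1) ha hb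
        exact ⟨T, hT.mono fun v hv => ⟨hv.1.1, hv.2, hv.1.2.2⟩⟩
  have h1 : ((N + 1 : ℕ) : ℝ) * e = 1 := by rw [he]; push_cast; field_simp
  have hrow : ∀ a : ℕ, a + 1 ≤ N + 1 →
      ∃ T, IsPrimitive φ K (Icc 0 ((a + 1 : ℕ) * e) ×ˢ Icc 0 1) T := by
    intro a
    induction a with
    | zero => intro ha; have := hcol 0 ha N le_rfl; rw [h1] at this; simpa using this
    | succ a ih =>
      intro ha
      refine exists_isPrimitive_glue hS (LinearMap.fst ℝ ℝ ℝ) ((a + 1 : ℕ) * e)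
        ((convex_Icc _ _).prod (convex_Icc _ _)) ?_ ?_
      · obtain ⟨T, hT⟩ := ih (by omega)
        exact ⟨T, hT.mono fun v hv => ⟨⟨hv.1.1.1, hv.2⟩, hv.1.2⟩⟩
      · obtain ⟨T, hT⟩ := hcol (a + 1) ha N le_rfl
        rw [h1] at hT
        exact ⟨T, hT.mono fun v hv => ⟨⟨hv.2, hv.1.1.2⟩, hv.1.2⟩⟩
  have := hrow N le_rfl
  rwa [h1] at this

/-- A path, extended by constants to the real line. -/
noncomputable def extendLine (γ : C(I, X)) : C(ℝ, X) := γ.comp ⟨projIcc 0 1 zero_le_one, continuous_projIcc⟩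

theorem extendLine_coe (γ : C(I, X)) (t : I) : extendLine γ t = γ t :=
  congrArg γ (projIcc_val zero_le_one t)

/-- The path is regarded as a map of the square that is constant in the second variable. -/
theorem exists_isPrimitive_path (hS : ∀ x, ∃ i, x ∈ interior (S i))
    (hφ : PathRep.Compatible φ) (γ : C(I, X)) :
    ∃ T, IsPrimitive φ (extendLine γ) (Icc 0 1) T := by
  obtain ⟨T, hT⟩ := exists_isPrimitive_square hS hφ
    ((extendLine γ).comp (⟨Prod.fst, continuous_fst⟩ : C(ℝ × ℝ, ℝ)))
  refine ⟨T ∘ fun t => (t, 0), hT.pullback (fun t : ℝ => (t, 0)) (fun v w t => ?_)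
    (convex_Icc _ _) (fun t ht => ⟨ht, by simp⟩) fun t ht => rfl⟩
  ext <;> simp [segPath_apply, AffineMap.lineMap_apply_module]

/-- The transport along a path determined by a compatible family of local representations. -/
noncomputable def transport (hS : ∀ x, ∃ i, x ∈ interior (S i))
    (hφ : PathRep.Compatible φ) (γ : C(I, X)) : H :=
  (exists_isPrimitive_path hS hφ γ).choose 1 * ((exists_isPrimitive_path hS hφ γ).choose 0)⁻¹

/-- Two primitives differ by a right factor, which cancels in `T 1 * (T 0)⁻¹`. -/
theorem transport_eq (hS : ∀ x, ∃ i, x ∈ interior (S i)) (hφ : PathRep.Compatible φ)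
    (γ : C(I, X)) {T : ℝ → H} (hT : IsPrimitive φ (extendLine γ) (Icc 0 1) T) :
    transport hS hφ γ = T 1 * (T 0)⁻¹ := by
  have h := IsPrimitive.unique hS (convex_Icc (0 : ℝ) 1)
    (exists_isPrimitive_path hS hφ γ).choose_spec hT (v := 1) (w := 0) (by simp) (by simp)
  unfold transport
  set T' := (exists_isPrimitive_path hS hφ γ).choose
  have h' : T 1 = T' 1 * ((T' 0)⁻¹ * T 0) := by rw [← h]; group
  rw [h']; group

/-- Needed for the two sides of the square on which a homotopy relative to the end points is
constant. -/
theorem IsPrimitive.const_path (hS : ∀ x, ∃ i, x ∈ interior (S i)) {K : C(E, X)} {A : Set E}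
    {T : E → H} (hT : IsPrimitive φ K A T) {v w : E} (hv : v ∈ A) (hw : w ∈ A)
    (h : ∀ t, K (segPath v w t) = K v) : T w = T v := by
  obtain ⟨i, hi⟩ := hS (K v)
  have hi' : K v ∈ S i := interior_subset hi
  rw [hT i v w hv hw fun t => (h t).symm ▸ hi']
  have e : (⟨fun t => ⟨K (segPath v w t), (h t).symm ▸ hi'⟩, by fun_prop⟩ : C(I, S i)) =
      ContinuousMap.const I ⟨K v, hi'⟩ := by
    ext t
    exact h t
  rw [e, PathRep.map_const, one_mul]

/-- The representation glued from a compatible family on a cover. -/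
noncomputable def PathRep.glue (hS : ∀ x, ∃ i, x ∈ interior (S i))
    (hφ : PathRep.Compatible φ) : PathRep X H where
  toFun := transport hS hφ
  map_trans {x y z} p q := by
    obtain ⟨T, hT⟩ := exists_isPrimitive_path hS hφ (p.trans q : C(I, X))
    have hp : IsPrimitive φ (extendLine (p : C(I, X))) (Icc 0 1) (T ∘ fun t => t / 2) := by
      refine hT.pullback _ (fun v w t => ?_) (convex_Icc _ _) (fun t ht => ?_) fun t ht => ?_
      · simp only [segPath_apply, AffineMap.lineMap_apply_module, smul_eq_mul]; ring
      · exact ⟨by linarith [ht.1], by linarith [ht.2]⟩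
      · rw [show extendLine (p : C(I, X)) t = p ⟨t, ht⟩ from extendLine_coe _ ⟨t, ht⟩]
        have ht' : t / 2 ∈ I := ⟨by linarith [ht.1], by linarith [ht.2]⟩
        refine Eq.trans ?_ (extendLine_coe (p.trans q : C(I, X)) ⟨t / 2, ht'⟩).symm
        change p ⟨t, ht⟩ = p.trans q ⟨t / 2, ht'⟩
        rw [Path.trans_apply, dif_pos (by change t / 2 ≤ 1 / 2; linarith [ht.2])]
        congr 1
        exact Subtype.ext (by change t = 2 * (t / 2); ring)
    have hq : IsPrimitive φ (extendLine (q : C(I, X))) (Icc 0 1) (T ∘ fun t => (t + 1) / 2) := by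
      refine hT.pullback _ (fun v w t => ?_) (convex_Icc _ _) (fun t ht => ?_) fun t ht => ?_
      · simp only [segPath_apply, AffineMap.lineMap_apply_module, smul_eq_mul]; ring
      · exact ⟨by linarith [ht.1], by linarith [ht.2]⟩
      · rw [show extendLine (q : C(I, X)) t = q ⟨t, ht⟩ from extendLine_coe _ ⟨t, ht⟩]
        have ht' : (t + 1) / 2 ∈ I := ⟨by linarith [ht.1], by linarith [ht.2]⟩
        refine Eq.trans ?_ (extendLine_coe (p.trans q : C(I, X)) ⟨(t + 1) / 2, ht'⟩).symm
        change q ⟨t, ht⟩ = p.trans q ⟨(t + 1) / 2, ht'⟩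
        rw [Path.trans_apply]
        -- The parameter 1/2 falls in the first branch of `Path.trans`. For `q` this is `t = 0`,
        -- where both branches give the common point of `p` and `q`.
        split_ifs with hc
        · change (t + 1) / 2 ≤ 1 / 2 at hc
          have h0 : t = 0 := le_antisymm (by linarith) ht.1
          subst h0
          have e1 : (⟨0, ht⟩ : I) = 0 := rfl
          rw [e1, q.source]
          refine p.target.symm.trans (congrArg p (Subtype.ext ?_))
          change (1 : ℝ) = 2 * ((0 + 1) / 2); norm_num
        · exact congrArg q (Subtype.ext (by change t = 2 * ((t + 1) / 2) - 1; ring))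
    rw [transport_eq hS hφ _ hT, transport_eq hS hφ _ hp, transport_eq hS hφ _ hq]
    simp only [Function.comp_apply]
    norm_num
  map_homotopic {x y} p q h := by
    obtain ⟨F⟩ := h
    let pr : C(ℝ, I) := ⟨projIcc 0 1 zero_le_one, continuous_projIcc⟩
    let K : C(ℝ × ℝ, X) := (F : C(I × I, X)).comp (pr.prodMap pr)
    have hK : ∀ a b, K (a, b) = F (pr a, pr b) := fun a b => rfl
    have pr0 : pr 0 = 0 := projIcc_left zero_le_one
    have pr1 : pr 1 = 1 := projIcc_right zero_le_one
    -- One primitive on the whole square restricts to primitives of `p` and of `q` on two opposite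
    -- sides; the other two sides are constant and identify the end values.
    obtain ⟨T, hT⟩ := exists_isPrimitive_square hS hφ K
    have hp : IsPrimitive φ (extendLine (p : C(I, X))) (Icc 0 1) (T ∘ fun t => (0, t)) := by
      refine hT.pullback _ (fun v w t => ?_) (convex_Icc _ _) (fun t ht => ⟨by simp, ht⟩)
        fun t ht => ?_
      · ext <;> simp [segPath_apply, AffineMap.lineMap_apply_module]
      · rw [hK, pr0, F.apply_zero]; rfl
    have hq : IsPrimitive φ (extendLine (q : C(I, X))) (Icc 0 1) (T ∘ fun t => (1, t)) := by
      refine hT.pullback _ (fun v w t => ?_) (convex_Icc _ _) (fun t ht => ⟨by simp, ht⟩)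
        fun t ht => ?_
      · ext
        · simp [segPath_apply, AffineMap.lineMap_apply_module]
        · simp [segPath_apply, AffineMap.lineMap_apply_module]
      · rw [hK, pr1, F.apply_one]; rfl
    rw [transport_eq hS hφ _ hp, transport_eq hS hφ _ hq]
    simp only [Function.comp_apply]
    have e0 : T (1, 0) = T (0, 0) := by
      refine hT.const_path hS (by simp) (by simp) fun t => ?_
      have : segPath ((0 : ℝ), (0 : ℝ)) (1, 0) t = (segPath (0 : ℝ) 1 t, 0) := by
        ext <;> simp [segPath_apply, AffineMap.lineMap_apply_module]
      rw [this, hK, hK, pr0, Path.Homotopy.source, Path.Homotopy.source]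
    have e1 : T (1, 1) = T (0, 1) := by
      refine hT.const_path hS (by simp) (by simp) fun t => ?_
      have : segPath ((0 : ℝ), (1 : ℝ)) (1, 1) t = (segPath (0 : ℝ) 1 t, 1) := by
        ext <;> simp [segPath_apply, AffineMap.lineMap_apply_module]
      rw [this, hK, hK, pr1, Path.Homotopy.target, Path.Homotopy.target]
    rw [e0, e1]

/-- The whole segment from 0 to 1 is mapped into `S i`, so the primitive property applies to it
without subdivision. -/
theorem PathRep.glue_apply (hS : ∀ x, ∃ i, x ∈ interior (S i)) (hφ : PathRep.Compatible φ)
    (i : ι) (γ : C(I, S i)) :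
    PathRep.glue hS hφ ((⟨Subtype.val, continuous_subtype_val⟩ : C(S i, X)).comp γ) = φ i γ := by
  set γ' := (⟨Subtype.val, continuous_subtype_val⟩ : C(S i, X)).comp γ with hγ'
  obtain ⟨T, hT⟩ := exists_isPrimitive_path hS hφ γ'
  have e : ∀ t : I, extendLine γ' (segPath (0 : ℝ) 1 t) = γ t := fun t => by
    rw [segPath_zero_one, extendLine_coe]; rfl
  have hm : ∀ t : I, extendLine γ' (segPath (0 : ℝ) 1 t) ∈ S i := fun t => e t ▸ (γ t).2
  change transport hS hφ γ' = _
  rw [transport_eq hS hφ _ hT, hT i 0 1 (by simp) (by simp) hm, mul_inv_cancel_right]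
  congr 1
  ext t
  exact e t

/-- A representation is determined by its restrictions to a cover. -/
theorem PathRep.eq_glue (hS : ∀ x, ∃ i, x ∈ interior (S i)) (hφ : PathRep.Compatible φ)
    (ψ : PathRep X H) (hψ : ∀ i (γ : C(I, S i)),
      ψ ((⟨Subtype.val, continuous_subtype_val⟩ : C(S i, X)).comp γ) = φ i γ) (γ : C(I, X)) :
    ψ γ = PathRep.glue hS hφ γ := by
  have hc : Convex ℝ (univ : Set ℝ) := convex_univ
  let ψ' : PathRep (univ : Set ℝ) H :=
    ψ.comap ((extendLine γ).comp ⟨Subtype.val, continuous_subtype_val⟩)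
  -- The values of `ψ` on the initial pieces of `γ` form a primitive, and `transport` may be
  -- computed from any primitive.
  have hT : IsPrimitive φ (extendLine γ) (Icc 0 1)
      fun w => ψ' (segPathIn hc (mem_univ 0) (mem_univ w) : C(I, (univ : Set ℝ))) := by
    intro i v w _ _ h
    exact (ψ'.triangle hc (mem_univ 0) (mem_univ v) (mem_univ w)).trans
      (congrArg (· * _) (hψ i ⟨fun t => ⟨extendLine γ (segPath v w t), h t⟩, by fun_prop⟩))
  change _ = transport hS hφ γ
  rw [transport_eq hS hφ _ hT]
  have e0 : ψ' (segPathIn hc (mem_univ 0) (mem_univ 0) : C(I, (univ : Set ℝ))) = 1 := by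
    rw [← ψ'.map_const ⟨0, mem_univ _⟩]
    congr 1
    ext t
    change segPath (0 : ℝ) 0 t = 0
    simp [segPath_apply]
  rw [e0, inv_one, mul_one]
  change ψ γ = ψ _
  congr 1
  ext t
  change γ t = extendLine γ (segPath (0 : ℝ) 1 t)
  rw [segPath_zero_one, extendLine_coe]

end Primitive

end VanKampenCore

/-! ### The van Kampen theorem for groupoids on a set of base points -/

section VanKampenGroupoid

open unitInterval Set Topology

/-- The restrictions of `ψ` are a compatible family, and both representations coincide with its
glueing. -/
theorem PathRep.eq_of_cover {X H ι : Type*} [TopologicalSpace X] [Group H] {S : ι → Set X}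
    (hS : ∀ x, ∃ i, x ∈ interior (S i)) (ψ ψ' : PathRep X H)
    (h : ∀ i (γ : C(I, S i)), ψ ((⟨Subtype.val, continuous_subtype_val⟩ : C(S i, X)).comp γ) =
      ψ' ((⟨Subtype.val, continuous_subtype_val⟩ : C(S i, X)).comp γ)) : ψ = ψ' := by
  have hφ : PathRep.Compatible
      fun i => ψ.comap (⟨Subtype.val, continuous_subtype_val⟩ : C(S i, X)) :=
    fun i j γ hi hj => rfl
  ext γ
  rw [PathRep.eq_glue hS hφ ψ (fun i γ => rfl), PathRep.eq_glue hS hφ ψ' fun i γ => (h i γ).symm]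

namespace Pi1

variable {Y : Type} [TopologicalSpace Y] {B : Set Y}

/-- The object of `Π₁(Y, B)` given by a base point. -/
def obj (b : B) : Pi1 Y B := b

/-- The base point underlying an object of `Π₁(Y, B)`. -/
def pt (b : Pi1 Y B) : Y := Subtype.val (p := (· ∈ B)) b

theorem pt_mem (b : Pi1 Y B) : pt b ∈ B := Subtype.property (p := (· ∈ B)) b

/-- The morphism of `Π₁(Y, B)` given by a path. -/
noncomputable def ofPath {b b' : Pi1 Y B} (p : Path (pt b) (pt b')) : b ⟶ b' :=
  InducedCategory.homMk (FundamentalGroupoid.fromPath (Path.Homotopic.Quotient.mk p))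

theorem exists_ofPath {b b' : Pi1 Y B} (f : b ⟶ b') : ∃ p, f = ofPath p := by
  obtain ⟨q⟩ := f
  obtain ⟨p, hp⟩ := Path.Homotopic.Quotient.mk_surjective (X := Y) q
  exact ⟨p, congrArg InducedCategory.homMk hp.symm⟩

theorem ofPath_congr {b b' : Pi1 Y B} {p q : Path (pt b) (pt b')} (h : p.Homotopic q) :
    ofPath p = ofPath q :=
  InducedCategory.hom_ext (Path.Homotopic.Quotient.eq.2 h)

variable (y₀ : Pi1 Y B) (γ : ∀ y : Y, Path y (pt y₀))

/-- A path, completed to a loop at the base point. -/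
noncomputable def completion {x y : Y} (p : Path x y) : Path (pt y₀) (pt y₀) :=
  ((γ x).symm.trans p).trans (γ y)

theorem completion_cast {x y x' y' : Y} (p : Path x y) (hx : x' = x) (hy : y' = y) :
    completion y₀ γ (p.cast hx hy) = completion y₀ γ p := by
  subst hx hy; rfl

theorem completion_trans {x y z : Y} (p : Path x y) (q : Path y z) :
    (completion y₀ γ (p.trans q)).Homotopic
      ((completion y₀ γ p).trans (completion y₀ γ q)) := by
  rw [← Path.Homotopic.Quotient.eq]
  simp only [completion, Path.Homotopic.Quotient.mk_trans, Path.Homotopic.Quotient.mk_symm,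
    Path.Homotopic.Quotient.trans_assoc]
  congr 2
  rw [← Path.Homotopic.Quotient.trans_assoc (Path.Homotopic.Quotient.mk (γ y)),
    Path.Homotopic.Quotient.trans_symm, Path.Homotopic.Quotient.refl_trans]

theorem completion_coe {x y : Y} (p : Path x y) :
    completion y₀ γ (⟨p, rfl, rfl⟩ : Path (p 0) (p 1)) = completion y₀ γ p :=
  completion_cast y₀ γ p p.source p.target

/-- The tautological representation of the paths of `Y` in the fundamental group. -/
noncomputable def loopRep : PathRep Y (End y₀) where
  toFun p := ofPath (completion y₀ γ (⟨p, rfl, rfl⟩ : Path (p 0) (p 1)))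
  map_trans {x y z} p q := by
    refine (congrArg ofPath (completion_coe y₀ γ (p.trans q))).trans ?_
    refine (ofPath_congr (completion_trans y₀ γ p q)).trans ?_
    exact congrArg₂ (fun a b : Path (pt y₀) (pt y₀) => ofPath a ≫ ofPath b)
      (completion_coe y₀ γ p).symm (completion_coe y₀ γ q).symm
  map_homotopic {x y} p q h := by
    refine (congrArg ofPath (completion_coe y₀ γ p)).trans
      (Eq.trans ?_ (congrArg ofPath (completion_coe y₀ γ q)).symm)
    exact ofPath_congr (((Path.Homotopic.refl _).hcomp h).hcomp (Path.Homotopic.refl _))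

theorem loopRep_coe {x y : Y} (p : Path x y) :
    loopRep y₀ γ (p : C(I, Y)) = ofPath (completion y₀ γ p) :=
  congrArg ofPath (completion_coe y₀ γ p)

theorem ofPath_comp_symm {b b' : Pi1 Y B} (p : Path (pt b) (pt b')) :
    ofPath p ≫ ofPath p.symm = 𝟙 b :=
  InducedCategory.hom_ext (Path.Homotopic.Quotient.trans_symm (Path.Homotopic.Quotient.mk p))

theorem ofPath_completion {b b' : Pi1 Y B} (p : Path (pt b) (pt b')) :
    ofPath (completion y₀ γ p) =
      (ofPath (γ (pt b)).symm : y₀ ⟶ b) ≫ ofPath p ≫ ofPath (γ (pt b')) := by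
  rw [← Category.assoc]
  rfl

/-- Every morphism is recovered from a loop at `y₀` and the chosen paths `γ`; this reduces the
groupoid to a vertex group. -/
theorem ofPath_eq {b b' : Pi1 Y B} (p : Path (pt b) (pt b')) :
    ofPath p = (ofPath (γ (pt b)) : b ⟶ y₀) ≫ ofPath (completion y₀ γ p) ≫
      ofPath (γ (pt b')).symm := by
  rw [ofPath_completion]
  simp only [Category.assoc]
  rw [ofPath_comp_symm, Category.comp_id, ← Category.assoc, ofPath_comp_symm, Category.id_comp]

theorem completion_mem {U : Set Y} (hγ : ∀ x ∈ U, ∀ t, γ x t ∈ U) {x y : Y} (p : Path x y)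
    (hp : ∀ t, p t ∈ U) (t : I) : completion y₀ γ p t ∈ U := by
  have h : completion y₀ γ p t ∈ range (completion y₀ γ p) := mem_range_self t
  rw [completion, Path.trans_range, Path.trans_range, Path.symm_range] at h
  have hx : x ∈ U := p.source ▸ hp 0
  have hy : y ∈ U := p.target ▸ hp 1
  rcases h with (⟨s, hs⟩ | ⟨s, hs⟩) | ⟨s, hs⟩
  · exact hs ▸ hγ x hx s
  · exact hs ▸ hp s
  · exact hs ▸ hγ y hy s

end Pi1

section Pushout

variable {X : Type} [TopologicalSpace X] {G : Type} [Groupoid.{0} G]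

/-- The inclusion of a subspace. -/
def subIncl (U : Set X) : C(U, X) := ⟨Subtype.val, continuous_subtype_val⟩

/-- A path with values in a subspace. -/
def Path.inSub {U : Set X} {x y : X} (p : Path x y) (hx : x ∈ U) (hy : y ∈ U)
    (h : ∀ t, p t ∈ U) : Path (⟨x, hx⟩ : U) ⟨y, hy⟩ where
  toFun t := ⟨p t, h t⟩
  source' := Subtype.ext p.source
  target' := Subtype.ext p.target

variable {S : Bool → Set X} {B : Set X}

/-- The functor `Π₁(U, B ∩ U) ⥤ Π₁(X, B)`. -/
noncomputable abbrev Pi1.incl (U B : Set X) : Pi1 U {u : U | (u : X) ∈ B} ⥤ Pi1 X B :=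
  Pi1.map (subIncl U) fun _ hu => hu

/-- An object of `Π₁(X, B)` as an object of `Π₁(U, B ∩ U)`. -/
def Pi1.objIn {U : Set X} (b : Pi1 X B) (h : Pi1.pt b ∈ U) : Pi1 U {u : U | (u : X) ∈ B} :=
  Pi1.obj (⟨⟨Pi1.pt b, h⟩, Pi1.pt_mem b⟩ : {u : U | (u : X) ∈ B})

/-- Functors on `Π₁(X, B)` are determined by their restrictions to a cover. -/
theorem Pi1.functor_ext (hS : ∀ x, ∃ i, x ∈ interior (S i)) (hB : ∀ i, B ⊆ S i) (x₀ : Pi1 X B)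
    (γ : ∀ x : X, Path x (Pi1.pt x₀)) (hγ : ∀ i x, x ∈ S i → ∀ t, γ x t ∈ S i)
    (m m' : Pi1 X B ⥤ G) (h : ∀ i, Pi1.incl (S i) B ⋙ m = Pi1.incl (S i) B ⋙ m') : m = m' := by
  have hobj : m.obj = m'.obj := by
    funext b
    exact Functor.congr_obj (h true) (objIn b (hB true (pt_mem b)))
  have hmap : ∀ i {b b' : Pi1 X B} (p : Path (pt b) (pt b')) (_ : ∀ t, p t ∈ S i),
      m.map (ofPath p) ≍ m'.map (ofPath p) := by
    intro i b b' p hp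
    exact Functor.hcongr_hom (h i)
      (ofPath (b := objIn b (hB i (pt_mem b))) (b' := objIn b' (hB i (pt_mem b')))
        (p.inSub (hB i (pt_mem b)) (hB i (pt_mem b')) hp))
  -- Substituting one object function for the other makes the hom types agree, so that heterogeneous
  -- equalities of morphisms become equalities.
  obtain ⟨o, mp, mid, mcomp⟩ := m
  obtain ⟨o', mp', mid', mcomp'⟩ := m'
  dsimp only at hobj
  subst hobj
  set m : Pi1 X B ⥤ G := ⟨o, @mp, mid, @mcomp⟩ with hm
  set m' : Pi1 X B ⥤ G := ⟨o, @mp', mid', @mcomp'⟩ with hm'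
  have hmap' : ∀ i {b b' : Pi1 X B} (p : Path (pt b) (pt b')) (_ : ∀ t, p t ∈ S i),
      m.map (ofPath p) = m'.map (ofPath p) := fun i b b' p hp => eq_of_heq (hmap i p hp)
  have hrep : (loopRep x₀ γ).mapHom (m.mapEnd x₀) = (loopRep x₀ γ).mapHom (m'.mapEnd x₀) :=
    PathRep.eq_of_cover hS _ _ fun i q =>
      hmap' i _ (completion_mem x₀ γ (hγ i) _ fun t => (q t).2)
  refine CategoryTheory.Functor.ext (fun b => rfl) fun b b' f => ?_
  simp only [eqToHom_refl, Category.id_comp, Category.comp_id]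
  obtain ⟨p, rfl⟩ := exists_ofPath f
  have e1 : m.map (ofPath (γ (pt b)) : b ⟶ x₀) = m'.map (ofPath (γ (pt b))) :=
    hmap' true _ (hγ true _ (hB true (pt_mem b)))
  have e2 : m.map (ofPath (γ (pt b')).symm : x₀ ⟶ b') = m'.map (ofPath (γ (pt b')).symm) :=
    hmap' true _ fun t => hγ true _ (hB true (pt_mem b')) _
  have e3 : m.map (ofPath (completion x₀ γ p)) = m'.map (ofPath (completion x₀ γ p)) := by
    have e := congrArg (fun φ : PathRep X (End (o x₀)) => φ (p : C(I, X))) hrep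
    change m.map (loopRep x₀ γ (p : C(I, X))) = m'.map (loopRep x₀ γ (p : C(I, X))) at e
    rwa [loopRep_coe] at e
  rw [ofPath_eq x₀ γ p]
  simp only [Functor.map_comp]
  rw [e1, e2, e3]

/-- Compatible functors on the members of a cover glue, when they have equal object functions. -/
theorem Pi1.exists_glue_of_obj (hS : ∀ x, ∃ i, x ∈ interior (S i)) (hB : ∀ i, B ⊆ S i)
    (x₀ : Pi1 X B) (γ : ∀ x : X, Path x (Pi1.pt x₀)) (hγ : ∀ i x, x ∈ S i → ∀ t, γ x t ∈ S i)
    (o : Pi1 X B → G)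
    (mp : ∀ i (b b' : Pi1 (S i) {u : S i | (u : X) ∈ B}), (b ⟶ b') →
      (o ((Pi1.incl (S i) B).obj b) ⟶ o ((Pi1.incl (S i) B).obj b')))
    (mid : ∀ i b, mp i b b (𝟙 b) = 𝟙 _)
    (mcomp : ∀ i b b' b'' f g, mp i b b'' (f ≫ g) = mp i b b' f ≫ mp i b' b'' g)
    (hcompat : ∀ i j {b b' : Pi1 X B} (p : Path (pt b) (pt b')) (hi : ∀ t, p t ∈ S i)
      (hj : ∀ t, p t ∈ S j),
      mp i (objIn b (hB i (pt_mem b))) (objIn b' (hB i (pt_mem b'))) (ofPath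
        (p.inSub (hB i (pt_mem b)) (hB i (pt_mem b')) hi)) =
      mp j (objIn b (hB j (pt_mem b))) (objIn b' (hB j (pt_mem b'))) (ofPath
        (p.inSub (hB j (pt_mem b)) (hB j (pt_mem b')) hj))) :
    ∃ m : Pi1 X B ⥤ G, ∀ i, Pi1.incl (S i) B ⋙ m =
      ⟨fun b => o ((Pi1.incl (S i) B).obj b), fun {b b'} f => mp i b b' f, mid i,
        fun {b b' b''} f g => mcomp i b b' b'' f g⟩ := by
  let M : ∀ i, Pi1 (S i) {u : S i | (u : X) ∈ B} ⥤ G := fun i =>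
    ⟨fun b => o ((Pi1.incl (S i) B).obj b), fun {b b'} f => mp i b b' f, mid i,
        fun {b b' b''} f g => mcomp i b b' b'' f g⟩
  let x₁ : ∀ i, Pi1 (S i) {u : S i | (u : X) ∈ B} := fun i => objIn x₀ (hB i (pt_mem x₀))
  let γ₁ : ∀ i (y : S i), Path y (pt (x₁ i)) := fun i y =>
    (γ y).inSub y.2 (hB i (pt_mem x₀)) (hγ i y y.2)
  -- A path in `S i` is completed along `γ` to a loop that stays in `S i`, and the functor on that
  -- piece is applied to the loop.
  let φ : ∀ i, PathRep (S i) (End (o x₀)) := fun i =>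
    (loopRep (x₁ i) (γ₁ i)).mapHom ((M i).mapEnd (x₁ i))
  have hcl : ∀ i {x y : S i} (p : Path x y),
      (completion (x₁ i) (γ₁ i) p).map continuous_subtype_val =
        completion x₀ γ (p.map continuous_subtype_val) := by
    intro i x y p
    simp only [completion]
    rw [Path.map_trans, Path.map_trans]
    rfl
  have hφ : PathRep.Compatible φ := by
    intro i j q hi hj
    have h := hcompat i j (b := x₀) (b' := x₀) (completion x₀ γ (⟨q, rfl, rfl⟩ : Path (q 0) (q 1)))
      (completion_mem x₀ γ (hγ i) _ hi) (completion_mem x₀ γ (hγ j) _ hj)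
    have e : ∀ k (hk : ∀ t, q t ∈ S k), φ k ⟨fun t => ⟨q t, hk t⟩, by fun_prop⟩ =
        mp k (x₁ k) (x₁ k) (ofPath ((completion x₀ γ (⟨q, rfl, rfl⟩ : Path (q 0) (q 1))).inSub
          (hB k (pt_mem x₀)) (hB k (pt_mem x₀)) (completion_mem x₀ γ (hγ k) _ hk))) := by
      intro k hk
      refine congrArg (fun p => mp k (x₁ k) (x₁ k) (ofPath p)) ?_
      ext t
      exact congrArg (fun p => p t) (hcl k (⟨⟨fun t => ⟨q t, hk t⟩, by fun_prop⟩, rfl, rfl⟩ :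
        Path (⟨q 0, hk 0⟩ : S k) ⟨q 1, hk 1⟩))
    rw [e i hi, e j hj, h]
  let Φ : PathRep X (End (o x₀)) := PathRep.glue hS hφ
  -- The image of `γ` at a base point is computed in the first piece; `hg` shows that either piece
  -- gives the same result.
  let g : ∀ b : Pi1 X B, o b ⟶ o x₀ := fun b =>
    (M true).map (X := objIn b (hB true (pt_mem b))) (Y := x₁ true) (ofPath (γ₁ true _))
  have hg : ∀ i (b : Pi1 (S i) {u : S i | (u : X) ∈ B}),
      g ((Pi1.incl (S i) B).obj b) = (M i).map (ofPath (γ₁ i (pt b)) : b ⟶ x₁ i) := fun i b =>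
    hcompat true i (b := (Pi1.incl (S i) B).obj b) (b' := x₀) (γ _)
      (hγ true _ (hB true (pt_mem _))) (hγ i _ (hB i (pt_mem ((Pi1.incl (S i) B).obj b))))
  let m : Pi1 X B ⥤ G :=
    { obj := o
      map := fun {b b'} f =>
        g b ≫ (show o x₀ ⟶ o x₀ from Φ.onClass (x := pt b) (y := pt b') f.hom) ≫ inv (g b')
      map_id := fun b => by
        have : Φ.onClass (x := pt b) (y := pt b) (InducedCategory.Hom.hom (𝟙 b)) = 𝟙 (o x₀) :=
          Φ.onClass_refl (pt b)
        rw [this, Category.id_comp, IsIso.hom_inv_id]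
      map_comp := fun {b b' b''} f f' => by
        have : Φ.onClass (x := pt b) (y := pt b'') (InducedCategory.Hom.hom (f ≫ f')) =
            (show o x₀ ⟶ o x₀ from Φ.onClass (x := pt b) (y := pt b') f.hom) ≫
              Φ.onClass (x := pt b') (y := pt b'') f'.hom :=
          Φ.onClass_trans (x := pt b) (y := pt b') (z := pt b'') f.hom f'.hom
        rw [this]
        simp }
  refine ⟨m, fun i => ?_⟩
  change Pi1.incl (S i) B ⋙ m = M i
  refine CategoryTheory.Functor.ext (fun b => rfl) fun b b' f => ?_
  simp only [eqToHom_refl, Category.id_comp, Category.comp_id]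
  obtain ⟨p, rfl⟩ := exists_ofPath f
  have e : Φ.onClass (Path.Homotopic.Quotient.mk (p.map continuous_subtype_val)) =
      (M i).map (ofPath (completion (x₁ i) (γ₁ i) p)) := by
    rw [PathRep.onClass_mk, ← loopRep_coe]
    exact PathRep.glue_apply hS hφ i (p : C(I, S i))
  change g ((Pi1.incl (S i) B).obj b) ≫ (show o x₀ ⟶ o x₀ from
    Φ.onClass (Path.Homotopic.Quotient.mk (p.map continuous_subtype_val))) ≫
      inv (g ((Pi1.incl (S i) B).obj b')) = _
  rw [e, hg, hg]
  have key : (M i).map (ofPath (γ₁ i (pt b)) : b ⟶ x₁ i) ≫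
      (M i).map (ofPath (completion (x₁ i) (γ₁ i) p)) ≫
        inv ((M i).map (ofPath (γ₁ i (pt b')) : b' ⟶ x₁ i)) = (M i).map (ofPath p) := by
    rw [← Category.assoc, IsIso.comp_inv_eq, ofPath_completion, ← Functor.map_comp,
      ← Functor.map_comp, ← Category.assoc, ofPath_comp_symm, Category.id_comp]
  exact key

/-- The cover of a space by two subspaces. -/
def pairCover (U V : Set X) : Bool → Set X := fun i => cond i U V

/-- Compatible functors on the members of a cover by two subspaces glue. -/
theorem Pi1.exists_glue {U V B : Set X} (hS : interior U ∪ interior V = univ) (hBU : B ⊆ U)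
    (hBV : B ⊆ V) (x₀ : Pi1 X B) (γ : ∀ x : X, Path x (Pi1.pt x₀))
    (hγU : ∀ x ∈ U, ∀ t, γ x t ∈ U) (hγV : ∀ x ∈ V, ∀ t, γ x t ∈ V)
    (f₁ : Pi1 U {u : U | (u : X) ∈ B} ⥤ G) (f₂ : Pi1 V {u : V | (u : X) ∈ B} ⥤ G)
    (h : (Pi1.map (ContinuousMap.inclusion inter_subset_left) fun _ hu => hu :
        Pi1 (U ∩ V : Set X) {u : (U ∩ V : Set X) | (u : X) ∈ B} ⥤ _) ⋙ f₁ =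
      Pi1.map (ContinuousMap.inclusion inter_subset_right) (fun _ hu => hu) ⋙ f₂) :
    ∃ m : Pi1 X B ⥤ G, Pi1.incl U B ⋙ m = f₁ ∧ Pi1.incl V B ⋙ m = f₂ := by
  let o : Pi1 X B → G := fun b => f₁.obj (objIn b (hBU (pt_mem b)))
  have hobj : f₂.obj = fun b => o ((Pi1.incl V B).obj b) := by
    funext b
    exact (Functor.congr_obj h (objIn (U := U ∩ V) ((Pi1.incl V B).obj b)
      ⟨hBU (pt_mem ((Pi1.incl V B).obj b)), hBV (pt_mem ((Pi1.incl V B).obj b))⟩)).symm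
  have hmap : ∀ {b b' : Pi1 X B} (p : Path (pt b) (pt b')) (hi : ∀ t, p t ∈ U)
      (hj : ∀ t, p t ∈ V),
      f₁.map (X := objIn b (hBU (pt_mem b))) (Y := objIn b' (hBU (pt_mem b')))
        (ofPath (p.inSub (hBU (pt_mem b)) (hBU (pt_mem b')) hi)) ≍
      f₂.map (X := objIn b (hBV (pt_mem b))) (Y := objIn b' (hBV (pt_mem b')))
        (ofPath (p.inSub (hBV (pt_mem b)) (hBV (pt_mem b')) hj)) := by
    intro b b' p hi hj
    exact Functor.hcongr_hom h
      (ofPath (b := objIn (U := U ∩ V) b ⟨hBU (pt_mem b), hBV (pt_mem b)⟩)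
        (b' := objIn (U := U ∩ V) b' ⟨hBU (pt_mem b'), hBV (pt_mem b')⟩)
        (p.inSub (U := U ∩ V) ⟨hBU (pt_mem b), hBV (pt_mem b)⟩ ⟨hBU (pt_mem b'), hBV (pt_mem b')⟩
          fun t => ⟨hi t, hj t⟩))
  clear h
  obtain ⟨o₂, mp₂, mid₂, mcomp₂⟩ := f₂
  dsimp only at hobj
  subst hobj
  have hB : ∀ i, B ⊆ pairCover U V i := fun i => by cases i <;> assumption
  obtain ⟨m, hm⟩ := Pi1.exists_glue_of_obj (S := pairCover U V)
    (fun x => by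
      rcases (hS.symm ▸ mem_univ x : x ∈ interior U ∪ interior V) with hx | hx
      · exact ⟨true, hx⟩
      · exact ⟨false, hx⟩)
    hB x₀ γ (fun i => by cases i <;> assumption) o
    (fun i => match i with
      | true => fun b b' f => f₁.map (X := b) (Y := b') f
      | false => fun b b' f => mp₂ (X := b) (Y := b') f)
    (fun i => match i with
      | true => fun b => f₁.map_id b
      | false => fun b => mid₂ b)
    (fun i => match i with
      | true => fun b b' b'' f g => f₁.map_comp f g
      | false => fun b b' b'' f g => mcomp₂ f g)
    (fun i j => match i, j with
      | true, true => fun p hi hj => rfl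
      | false, false => fun p hi hj => rfl
      | true, false => fun p hi hj => eq_of_heq (hmap p hi hj)
      | false, true => fun p hi hj => (eq_of_heq (hmap p hj hi)).symm)
  exact ⟨m, hm true, hm false⟩

/-- The van Kampen theorem for the fundamental groupoid on a set of base points, for a cover by
the interiors of two path connected subspaces with path connected intersection. -/
theorem vanKampenIso {U V B : Set X} (hS : interior U ∪ interior V = univ)
    (hU : IsPathConnected U) (hV : IsPathConnected V) (hUV : IsPathConnected (U ∩ V))
    (hB : B ⊆ U ∩ V) (hne : B.Nonempty) : VanKampenIso U V B := by
  classical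
  obtain ⟨b₀, hb₀⟩ := hne
  -- A point of both pieces is joined to `b₀` inside the intersection, so that its path serves for
  -- both at once.
  have hγ : ∀ x : X, ∃ γ : Path x b₀, (x ∈ U → ∀ t, γ t ∈ U) ∧ (x ∈ V → ∀ t, γ t ∈ V) := by
    intro x
    by_cases hxU : x ∈ U
    · by_cases hxV : x ∈ V
      · obtain ⟨γ, hγ⟩ := hUV.joinedIn x ⟨hxU, hxV⟩ b₀ (hB hb₀)
        exact ⟨γ, fun _ t => (hγ t).1, fun _ t => (hγ t).2⟩
      · obtain ⟨γ, hγ⟩ := hU.joinedIn x hxU b₀ (hB hb₀).1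
        exact ⟨γ, fun _ => hγ, fun h => absurd h hxV⟩
    · have hxV : x ∈ V := by
        rcases (hS.symm ▸ mem_univ x : x ∈ interior U ∪ interior V) with hx | hx
        · exact absurd (interior_subset hx) hxU
        · exact interior_subset hx
      obtain ⟨γ, hγ⟩ := hV.joinedIn x hxV b₀ (hB hb₀).2
      exact ⟨γ, fun h => absurd h hxU, fun _ => hγ⟩
  choose γ hγU hγV using hγ
  have hcov : ∀ x, ∃ i, x ∈ interior (pairCover U V i) := fun x => by
    rcases (hS.symm ▸ mem_univ x : x ∈ interior U ∪ interior V) with hx | hx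
    · exact ⟨true, hx⟩
    · exact ⟨false, hx⟩
  have hBU : B ⊆ U := fun x hx => (hB hx).1
  have hBV : B ⊆ V := fun x hx => (hB hx).2
  have hsq : pi1Incl (inter_subset_left : U ∩ V ⊆ U) B ≫ pi1InclTop U B =
      pi1Incl (inter_subset_right : U ∩ V ⊆ V) B ≫ pi1InclTop V B := by
    have hfun : (Pi1.map (ContinuousMap.inclusion inter_subset_left) fun _ hu => hu :
        Pi1 (U ∩ V : Set X) {u : (U ∩ V : Set X) | (u : X) ∈ B} ⥤ _) ⋙ Pi1.incl U B =
      Pi1.map (ContinuousMap.inclusion inter_subset_right) (fun _ hu => hu) ⋙ Pi1.incl V B := by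
      refine CategoryTheory.Functor.ext (fun b => rfl) fun b b' f => ?_
      obtain ⟨p, rfl⟩ := Pi1.exists_ofPath f
      exact ((Category.id_comp _).trans (Category.comp_id _)).symm
    exact hfun
  refine ⟨⟨hsq⟩, ⟨Limits.PushoutCocone.IsColimit.mk hsq
    (fun s => (Pi1.exists_glue hS hBU hBV (Pi1.obj ⟨b₀, hb₀⟩) γ hγU hγV s.inl s.inr
      s.condition).choose)
    (fun s => (Pi1.exists_glue hS hBU hBV (Pi1.obj ⟨b₀, hb₀⟩) γ hγU hγV s.inl s.inr
      s.condition).choose_spec.1)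
    (fun s => (Pi1.exists_glue hS hBU hBV (Pi1.obj ⟨b₀, hb₀⟩) γ hγU hγV s.inl s.inr
      s.condition).choose_spec.2)
    fun s m h₁ h₂ => ?_⟩⟩
  have hs := (Pi1.exists_glue hS hBU hBV (Pi1.obj ⟨b₀, hb₀⟩) γ hγU hγV s.inl s.inr
      s.condition).choose_spec
  refine Pi1.functor_ext (S := pairCover U V) hcov (fun i => by cases i <;> assumption)
    (Pi1.obj ⟨b₀, hb₀⟩) γ (fun i => by cases i <;> assumption) _ _ fun i => ?_
  cases i
  · exact h₂.trans hs.2.symm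
  · exact h₁.trans hs.1.symm

end Pushout

end VanKampenGroupoid

/-! ### Second moments and deformations of configurations -/

namespace UConf

open Topology Set

variable {n : ℕ}

theorem mk_surjective : Function.Surjective (mk : OConf n → UConf n) := Quotient.mk_surjective

theorem mk_eq {z w : OConf n} (σ : Equiv.Perm (Fin n)) (h : ∀ i, w.1 i = z.1 (σ i)) :
    mk z = mk w := Quotient.sound (s := OConf.setoid n) ⟨σ, h⟩

/-- Relabelling as a homeomorphism. -/
def relabel (σ : Equiv.Perm (Fin n)) : OConf n ≃ₜ OConf n where
  toFun z := ⟨fun i => z.1 (σ i), z.2.comp σ.injective⟩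
  invFun z := ⟨fun i => z.1 (σ⁻¹ i), z.2.comp (σ⁻¹ : Equiv.Perm _).injective⟩
  left_inv z := by ext i; simp
  right_inv z := by ext i; simp
  continuous_toFun := by
    refine Continuous.subtype_mk (continuous_pi fun i => ?_) _
    exact (continuous_apply (σ i)).comp continuous_subtype_val
  continuous_invFun := by
    refine Continuous.subtype_mk (continuous_pi fun i => ?_) _
    exact (continuous_apply (σ⁻¹ i)).comp continuous_subtype_val

/-- The saturation of an open set is a union of its relabellings. Openness matters because open
quotient maps are stable under products, which gives joint continuity of `deform` in parameters and
configuration. -/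
theorem isOpenQuotientMap_mk : IsOpenQuotientMap (mk : OConf n → UConf n) := by
  refine ⟨mk_surjective, continuous_quot_mk, fun V hV => ?_⟩
  refine isOpen_coinduced.2 ?_
  have : (mk ⁻¹' (mk '' V) : Set (OConf n)) = ⋃ σ : Equiv.Perm (Fin n), relabel σ ⁻¹' V := by
    ext z
    simp only [mem_preimage, mem_image, mem_iUnion]
    constructor
    · rintro ⟨w, hw, h⟩
      obtain ⟨σ, hσ⟩ := Quotient.exact (s := OConf.setoid n) h.symm
      refine ⟨σ, ?_⟩
      have : relabel σ z = w := Subtype.ext (funext fun i => (hσ i).symm)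
      rwa [this]
    · rintro ⟨σ, h⟩
      exact ⟨_, h, (mk_eq σ fun i => rfl).symm⟩
  change IsOpen (mk ⁻¹' (mk '' V))
  rw [this]
  exact isOpen_iUnion fun σ => hV.preimage (relabel σ).continuous

theorem continuous_mk : Continuous (mk : OConf n → UConf n) := continuous_quot_mk

/-- A symmetric function of the labelled points, as a function on unordered configurations. -/
def lift {α : Type*} (f : (Fin n → ℂ) → α)
    (hf : ∀ z (σ : Equiv.Perm (Fin n)), f (fun i => z (σ i)) = f z) : UConf n → α :=
  Quotient.lift (s := OConf.setoid n) (fun z => f z.1) fun z w ⟨σ, h⟩ => by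
    rw [← hf z.1 σ]
    exact congrArg f (funext fun i => (h i).symm)

theorem continuous_lift {α : Type*} [TopologicalSpace α] {f : (Fin n → ℂ) → α} (hc : Continuous f)
    (hf : ∀ z (σ : Equiv.Perm (Fin n)), f (fun i => z (σ i)) = f z) : Continuous (lift f hf) :=
  isOpenQuotientMap_mk.isQuotientMap.continuous_iff.2 (hc.comp continuous_subtype_val)

/-- The centre of mass of labelled points. -/
noncomputable def mean (z : Fin n → ℂ) : ℂ := (∑ i, z i) / n

/-- The real part of a point relative to the centre of mass. -/
noncomputable def relRe (z : Fin n → ℂ) (i : Fin n) : ℝ := (z i).re - (mean z).re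

/-- The imaginary part of a point relative to the centre of mass. -/
noncomputable def relIm (z : Fin n → ℂ) (i : Fin n) : ℝ := (z i).im - (mean z).im

theorem mean_perm (z : Fin n → ℂ) (σ : Equiv.Perm (Fin n)) : mean (fun i => z (σ i)) = mean z := by
  rw [mean, mean, Equiv.sum_comp σ z]

theorem relRe_perm (z : Fin n → ℂ) (σ : Equiv.Perm (Fin n)) (i : Fin n) :
    relRe (fun i => z (σ i)) i = relRe z (σ i) := by
  rw [relRe, relRe, mean_perm]

theorem relIm_perm (z : Fin n → ℂ) (σ : Equiv.Perm (Fin n)) (i : Fin n) :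
    relIm (fun i => z (σ i)) i = relIm z (σ i) := by
  rw [relIm, relIm, mean_perm]

theorem continuous_mean : Continuous (mean : (Fin n → ℂ) → ℂ) := by
  unfold mean; fun_prop

theorem continuous_relRe (i : Fin n) : Continuous fun z : Fin n → ℂ => relRe z i := by
  unfold relRe
  exact (Complex.continuous_re.comp (continuous_apply i)).sub
    (Complex.continuous_re.comp continuous_mean)

theorem continuous_relIm (i : Fin n) : Continuous fun z : Fin n → ℂ => relIm z i := by
  unfold relIm
  exact (Complex.continuous_im.comp (continuous_apply i)).sub
    (Complex.continuous_im.comp continuous_mean)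

/-- The second moment of the real parts. -/
noncomputable def momRe : UConf n → ℝ :=
  lift (fun z => ∑ i, relRe z i ^ 2) fun z σ => by
    simp only [relRe_perm]; exact Equiv.sum_comp σ fun i => relRe z i ^ 2

/-- The mixed second moment of the real and imaginary parts. -/
noncomputable def momMix : UConf n → ℝ :=
  lift (fun z => ∑ i, relRe z i * relIm z i) fun z σ => by
    simp only [relRe_perm, relIm_perm]; exact Equiv.sum_comp σ fun i => relRe z i * relIm z i

/-- The second moment of the imaginary parts. -/
noncomputable def momIm : UConf n → ℝ :=
  lift (fun z => ∑ i, relIm z i ^ 2) fun z σ => by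
    simp only [relIm_perm]; exact Equiv.sum_comp σ fun i => relIm z i ^ 2

/-- The imaginary part of the centre of mass. -/
noncomputable def height : UConf n → ℝ :=
  lift (fun z => (mean z).im) fun z σ => by simp only [mean_perm]

theorem momRe_mk (z : OConf n) : momRe (mk z) = ∑ i, relRe z.1 i ^ 2 := rfl
theorem momMix_mk (z : OConf n) : momMix (mk z) = ∑ i, relRe z.1 i * relIm z.1 i := rfl
theorem momIm_mk (z : OConf n) : momIm (mk z) = ∑ i, relIm z.1 i ^ 2 := rfl
theorem height_mk (z : OConf n) : height (mk z) = (mean z.1).im := rfl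

@[fun_prop]
theorem continuous_momRe : Continuous (momRe : UConf n → ℝ) :=
  continuous_lift (continuous_finsetSum _ fun i _ => (continuous_relRe i).pow 2) _

@[fun_prop]
theorem continuous_momMix : Continuous (momMix : UConf n → ℝ) :=
  continuous_lift (continuous_finsetSum _ fun i _ => (continuous_relRe i).mul (continuous_relIm i)) _

@[fun_prop]
theorem continuous_momIm : Continuous (momIm : UConf n → ℝ) :=
  continuous_lift (continuous_finsetSum _ fun i _ => (continuous_relIm i).pow 2) _

@[fun_prop]
theorem continuous_height : Continuous (height : UConf n → ℝ) :=
  continuous_lift (Complex.continuous_im.comp continuous_mean) _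

theorem momRe_nonneg (x : UConf n) : 0 ≤ momRe x := by
  obtain ⟨z, rfl⟩ := mk_surjective x
  rw [momRe_mk]
  exact Finset.sum_nonneg fun i _ => sq_nonneg (relRe z.1 i)

theorem momIm_nonneg (x : UConf n) : 0 ≤ momIm x := by
  obtain ⟨z, rfl⟩ := mk_surjective x
  rw [momIm_mk]
  exact Finset.sum_nonneg fun i _ => sq_nonneg (relIm z.1 i)

theorem momMix_sq_le (x : UConf n) : momMix x ^ 2 ≤ momRe x * momIm x := by
  obtain ⟨z, rfl⟩ := mk_surjective x
  rw [momMix_mk, momRe_mk, momIm_mk]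
  exact Finset.sum_mul_sq_le_sq_mul_sq _ (relRe z.1) (relIm z.1)

/-- If the sum vanished, all points would equal the centre of mass, contrary to there being two
distinct ones. -/
theorem momRe_add_momIm_pos (hn : 2 ≤ n) (x : UConf n) : 0 < momRe x + momIm x := by
  obtain ⟨z, rfl⟩ := mk_surjective x
  rw [momRe_mk, momIm_mk, ← Finset.sum_add_distrib]
  have hnn : ∀ i, 0 ≤ relRe z.1 i ^ 2 + relIm z.1 i ^ 2 := fun i => by positivity
  refine lt_of_le_of_ne (Finset.sum_nonneg fun i _ => hnn i) fun h => ?_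
  have h0 := (Finset.sum_eq_zero_iff_of_nonneg fun i _ => hnn i).1 h.symm
  have hz : ∀ i, z.1 i = mean z.1 := fun i => by
    have := h0 i (Finset.mem_univ i)
    have h1 : relRe z.1 i = 0 := by nlinarith [sq_nonneg (relRe z.1 i), sq_nonneg (relIm z.1 i)]
    have h2 : relIm z.1 i = 0 := by nlinarith [sq_nonneg (relRe z.1 i), sq_nonneg (relIm z.1 i)]
    exact Complex.ext (sub_eq_zero.1 h1) (sub_eq_zero.1 h2)
  have := z.2 ((hz ⟨0, by omega⟩).trans (hz ⟨1, by omega⟩).symm)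
  simp at this

theorem mean_re (z : Fin n → ℂ) : (mean z).re = (∑ i, (z i).re) / n := by
  rw [mean, ← Complex.re_sum, ← Complex.ofReal_natCast, Complex.div_ofReal_re]

theorem mean_im (z : Fin n → ℂ) : (mean z).im = (∑ i, (z i).im) / n := by
  rw [mean, ← Complex.im_sum, ← Complex.ofReal_natCast, Complex.div_ofReal_im]

theorem sum_relRe (z : Fin n → ℂ) : ∑ i, relRe z i = 0 := by
  rcases eq_or_ne n 0 with rfl | hn
  · simp
  · simp only [relRe, mean_re, Finset.sum_sub_distrib, Finset.sum_const, Finset.card_univ,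
      Fintype.card_fin, nsmul_eq_mul]
    field_simp
    simp

theorem sum_relIm (z : Fin n → ℂ) : ∑ i, relIm z i = 0 := by
  rcases eq_or_ne n 0 with rfl | hn
  · simp
  · simp only [relIm, mean_im, Finset.sum_sub_distrib, Finset.sum_const, Finset.card_univ,
      Fintype.card_fin, nsmul_eq_mul]
    field_simp
    simp

/-- If the points are given relative to some point by centred coordinates, these are the relative
coordinates. -/
theorem rel_of_centred (hn : n ≠ 0) {z : Fin n → ℂ} {m : ℂ} {x y : Fin n → ℝ}
    (hx : ∑ i, x i = 0) (hy : ∑ i, y i = 0) (h : ∀ i, z i = m + ⟨x i, y i⟩) :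
    mean z = m ∧ relRe z = x ∧ relIm z = y := by
  have hm : mean z = m := by
    refine Complex.ext ?_ ?_
    · rw [mean_re]
      simp only [h, Complex.add_re, Finset.sum_add_distrib, hx, Finset.sum_const,
        Finset.card_univ, Fintype.card_fin, nsmul_eq_mul]
      field_simp
      simp
    · rw [mean_im]
      simp only [h, Complex.add_im, Finset.sum_add_distrib, hy, Finset.sum_const,
        Finset.card_univ, Fintype.card_fin, nsmul_eq_mul]
      field_simp
      simp
  refine ⟨hm, funext fun i => ?_, funext fun i => ?_⟩
  · rw [relRe, hm, h]; simp
  · rw [relIm, hm, h]; simp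

theorem eq_mean_add (z : Fin n → ℂ) (i : Fin n) : z i = mean z + ⟨relRe z i, relIm z i⟩ :=
  Complex.ext (by simp [relRe]) (by simp [relIm])

/-- Stretch the real parts by `exp s` and shear the imaginary parts with slope `r`, relative to the
centre of mass, and raise by `t`. -/
noncomputable def deformFun (s r t : ℝ) (z : Fin n → ℂ) (i : Fin n) : ℂ :=
  (mean z + ⟨0, t⟩) + ⟨Real.exp s * relRe z i, relIm z i + r * relRe z i⟩

theorem deformFun_injective (s r t : ℝ) {z : Fin n → ℂ} (hz : Function.Injective z) :
    Function.Injective (deformFun s r t z) := by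
  intro i j h
  have h' := add_left_cancel h
  rw [Complex.mk.injEq] at h'
  have h1 : relRe z i = relRe z j := mul_left_cancel₀ (Real.exp_ne_zero s) h'.1
  have h2 : relIm z i = relIm z j := by
    have := h'.2
    rw [h1] at this
    exact add_right_cancel this
  refine hz ?_
  rw [eq_mean_add z i, eq_mean_add z j, h1, h2]

/-- The deformation `deformFun` of unordered configurations. -/
noncomputable def deform (s r t : ℝ) : UConf n → UConf n :=
  Quotient.map (sa := OConf.setoid n) (sb := OConf.setoid n)
    (fun z => ⟨deformFun s r t z.1, deformFun_injective s r t z.2⟩)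
    fun z w ⟨σ, h⟩ => ⟨σ, fun i => by
      have e : w.1 = fun i => z.1 (σ i) := funext h
      change deformFun s r t w.1 i = deformFun s r t z.1 (σ i)
      rw [e, deformFun, deformFun, mean_perm, relRe_perm, relIm_perm]⟩

theorem deform_mk (s r t : ℝ) (z : OConf n) :
    deform s r t (mk z) = mk ⟨deformFun s r t z.1, deformFun_injective s r t z.2⟩ := rfl

theorem continuous_deform :
    Continuous fun p : (ℝ × ℝ × ℝ) × UConf n => deform p.1.1 p.1.2.1 p.1.2.2 p.2 := by
  refine ((IsOpenQuotientMap.id (X := ℝ × ℝ × ℝ)).prodMap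
    (isOpenQuotientMap_mk (n := n))).isQuotientMap.continuous_iff.2 ?_
  refine continuous_mk.comp (Continuous.subtype_mk (continuous_pi fun i => ?_) fun p => ?_)
  · change Continuous fun p : (ℝ × ℝ × ℝ) × OConf n => deformFun p.1.1 p.1.2.1 p.1.2.2 p.2.1 i
    have hre : Continuous fun p : (ℝ × ℝ × ℝ) × OConf n => relRe p.2.1 i :=
      (continuous_relRe i).comp (by fun_prop)
    have him : Continuous fun p : (ℝ × ℝ × ℝ) × OConf n => relIm p.2.1 i :=
      (continuous_relIm i).comp (by fun_prop)
    have hm : Continuous fun p : (ℝ × ℝ × ℝ) × OConf n => mean p.2.1 :=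
      continuous_mean.comp (by fun_prop)
    have hmk : ∀ {f g : (ℝ × ℝ × ℝ) × OConf n → ℝ}, Continuous f → Continuous g →
        Continuous fun p => (⟨f p, g p⟩ : ℂ) := fun hf hg =>
      Complex.equivRealProdCLM.symm.continuous.comp (hf.prodMk hg)
    unfold deformFun
    exact (hm.add (hmk (by fun_prop) (by fun_prop))).add
      (hmk ((Real.continuous_exp.comp (by fun_prop)).mul hre)
        (him.add (Continuous.mul (by fun_prop) hre)))
  · exact deformFun_injective _ _ _ p.2.2

/-- Stretching and shearing centred coordinates leaves them centred. -/
theorem deformFun_rel (hn : n ≠ 0) (s r t : ℝ) (z : Fin n → ℂ) :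
    mean (deformFun s r t z) = mean z + ⟨0, t⟩ ∧
    (relRe (deformFun s r t z) = fun i => Real.exp s * relRe z i) ∧
    relIm (deformFun s r t z) = fun i => relIm z i + r * relRe z i :=
  rel_of_centred hn (by rw [← Finset.mul_sum, sum_relRe, mul_zero])
    (by rw [Finset.sum_add_distrib, ← Finset.mul_sum, sum_relRe, sum_relIm]; simp) fun i => rfl

theorem momRe_deform (hn : n ≠ 0) (s r t : ℝ) (x : UConf n) :
    momRe (deform s r t x) = Real.exp s ^ 2 * momRe x := by
  obtain ⟨z, rfl⟩ := mk_surjective x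
  rw [deform_mk, momRe_mk, (deformFun_rel hn s r t z.1).2.1, momRe_mk, Finset.mul_sum]
  exact Finset.sum_congr rfl fun i _ => by ring

theorem momMix_deform (hn : n ≠ 0) (s r t : ℝ) (x : UConf n) :
    momMix (deform s r t x) = Real.exp s * (momMix x + r * momRe x) := by
  obtain ⟨z, rfl⟩ := mk_surjective x
  rw [deform_mk, momMix_mk, (deformFun_rel hn s r t z.1).2.1, (deformFun_rel hn s r t z.1).2.2,
    momMix_mk, momRe_mk, Finset.mul_sum, ← Finset.sum_add_distrib, Finset.mul_sum]
  exact Finset.sum_congr rfl fun i _ => by ring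

theorem momIm_deform (hn : n ≠ 0) (s r t : ℝ) (x : UConf n) :
    momIm (deform s r t x) = momIm x + 2 * r * momMix x + r ^ 2 * momRe x := by
  obtain ⟨z, rfl⟩ := mk_surjective x
  rw [deform_mk, momIm_mk, (deformFun_rel hn s r t z.1).2.2,
    momIm_mk, momMix_mk, momRe_mk, Finset.mul_sum, Finset.mul_sum, ← Finset.sum_add_distrib,
    ← Finset.sum_add_distrib]
  exact Finset.sum_congr rfl fun i _ => by ring

theorem height_deform (hn : n ≠ 0) (s r t : ℝ) (x : UConf n) :
    height (deform s r t x) = height x + t := by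
  obtain ⟨z, rfl⟩ := mk_surjective x
  rw [deform_mk, height_mk, (deformFun_rel hn s r t z.1).1, height_mk, Complex.add_im]

theorem deform_zero (x : UConf n) : deform 0 0 0 x = x := by
  obtain ⟨z, rfl⟩ := mk_surjective x
  rw [deform_mk]
  congr 1
  refine Subtype.ext (funext fun i => ?_)
  refine Eq.trans ?_ (eq_mean_add z.1 i).symm
  refine Complex.ext ?_ ?_ <;> simp [deformFun]

theorem deform_deform (hn : n ≠ 0) (s r t s' r' t' : ℝ) (x : UConf n) :
    deform s' r' t' (deform s r t x) = deform (s + s') (r + r' * Real.exp s) (t + t') x := by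
  obtain ⟨z, rfl⟩ := mk_surjective x
  rw [deform_mk, deform_mk, deform_mk]
  congr 2
  funext i
  obtain ⟨h1, h2, h3⟩ := deformFun_rel hn s r t z.1
  dsimp only
  rw [deformFun, h1, h2, h3, deformFun]
  refine Complex.ext ?_ ?_
  · simp only [Complex.add_re, Real.exp_add]; ring
  · simp only [Complex.add_im]; ring

end UConf

/-! ### Width, tilt, thickness and height; the maps `slide` and `push` -/

namespace UConf

open Topology Set

variable {n : ℕ}

/-- The configurations that do not lie on a vertical line. -/
def spread (n : ℕ) : Set (UConf n) := {x | 0 < momRe x}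

theorem isOpen_spread : IsOpen (spread n) := isOpen_lt continuous_const continuous_momRe

/-- The horizontal size of a configuration. -/
noncomputable def width (x : UConf n) : ℝ := √(momRe x)

/-- The normalized mixed moment. -/
noncomputable def tilt (x : UConf n) : ℝ := momMix x / width x

/-- The second moment of the imaginary parts, after a shear that makes the mixed moment vanish. -/
noncomputable def thick (x : UConf n) : ℝ := momIm x - tilt x ^ 2

theorem width_pos {x : UConf n} (hx : x ∈ spread n) : 0 < width x := Real.sqrt_pos.2 hx

theorem width_sq (x : UConf n) : width x ^ 2 = momRe x := Real.sq_sqrt (momRe_nonneg x)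

theorem width_mul_tilt {x : UConf n} (hx : x ∈ spread n) : width x * tilt x = momMix x :=
  mul_div_cancel₀ _ (width_pos hx).ne'

/-- This is the Cauchy–Schwarz inequality: `thick` is the squared length of the part of the
imaginary vector orthogonal to the real one. -/
theorem thick_nonneg {x : UConf n} (hx : x ∈ spread n) : 0 ≤ thick x := by
  have h := momMix_sq_le x
  rw [← width_mul_tilt hx, ← width_sq, mul_pow] at h
  have := le_of_mul_le_mul_left h (pow_pos (width_pos hx) 2)
  rw [thick]; linarith

@[fun_prop]
theorem continuous_width : Continuous (width : UConf n → ℝ) := by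
  unfold width; fun_prop

theorem continuousOn_tilt : ContinuousOn (tilt : UConf n → ℝ) (spread n) :=
  continuous_momMix.continuousOn.div continuous_width.continuousOn fun _ hx => (width_pos hx).ne'

theorem continuousOn_thick : ContinuousOn (thick : UConf n → ℝ) (spread n) :=
  continuous_momIm.continuousOn.sub (continuousOn_tilt.pow 2)

/-- Deform a configuration so as to give it prescribed width, tilt and height. -/
noncomputable def place (l t m : ℝ) (x : UConf n) : UConf n :=
  deform (Real.log (l / width x)) ((t - tilt x) / width x) (m - height x) x

section place

variable {l t m : ℝ} {x : UConf n}

theorem exp_log_div (hx : x ∈ spread n) (hl : 0 < l) :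
    Real.exp (Real.log (l / width x)) = l / width x :=
  Real.exp_log (div_pos hl (width_pos hx))

theorem momRe_place (hn : n ≠ 0) (hx : x ∈ spread n) (hl : 0 < l) :
    momRe (place l t m x) = l ^ 2 := by
  have := (width_pos hx).ne'
  rw [place, momRe_deform hn, exp_log_div hx hl, ← width_sq]
  field_simp

theorem place_mem (hn : n ≠ 0) (hx : x ∈ spread n) (hl : 0 < l) : place l t m x ∈ spread n := by
  change 0 < momRe _
  rw [momRe_place hn hx hl]
  positivity

theorem width_place (hn : n ≠ 0) (hx : x ∈ spread n) (hl : 0 < l) :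
    width (place l t m x) = l := by
  rw [width, momRe_place hn hx hl, Real.sqrt_sq hl.le]

theorem tilt_place (hn : n ≠ 0) (hx : x ∈ spread n) (hl : 0 < l) :
    tilt (place l t m x) = t := by
  have := (width_pos hx).ne'
  have := hl.ne'
  rw [tilt, width_place hn hx hl, place, momMix_deform hn, exp_log_div hx hl, ← width_sq,
    ← width_mul_tilt hx]
  field_simp
  ring

/-- Shearing adds to the imaginary vector a multiple of the real one, so the orthogonal part is
unchanged. -/
theorem thick_place (hn : n ≠ 0) (hx : x ∈ spread n) (hl : 0 < l) :
    thick (place l t m x) = thick x := by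
  have := (width_pos hx).ne'
  rw [thick, tilt_place hn hx hl, place, momIm_deform hn, ← width_sq, ← width_mul_tilt hx, thick]
  field_simp
  ring

theorem height_place (hn : n ≠ 0) : height (place l t m x) = m := by
  rw [place, height_deform hn]; ring

/-- The deformations compose as a group, and the one applied by `place` is determined by the initial
and final width, tilt and height; hence only the last prescription counts. -/
theorem place_place (hn : n ≠ 0) (hx : x ∈ spread n) (hl : 0 < l) {l' t' m' : ℝ} (hl' : 0 < l') :
    place l' t' m' (place l t m x) = place l' t' m' x := by
  have h0 := width_pos hx
  have h1 : width (place l t m x) = l := width_place hn hx hl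
  have h2 : tilt (place l t m x) = t := tilt_place hn hx hl
  have h3 : height (place l t m x) = m := height_place hn
  rw [place, h1, h2, h3, place, deform_deform hn, exp_log_div hx hl, place]
  congr 1
  · rw [← Real.log_mul (div_pos hl h0).ne' (div_pos hl' hl).ne']
    congr 1
    field_simp
  · field_simp
    ring
  · ring

theorem place_self (hx : x ∈ spread n) : place (width x) (tilt x) (height x) x = x := by
  rw [place, div_self (width_pos hx).ne', sub_self, sub_self, Real.log_one, zero_div, deform_zero]

theorem continuousOn_place {A : Type*} [TopologicalSpace A] {D : Set A} {l t m : A → ℝ}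
    {f : A → UConf n} (hl : ContinuousOn l D) (ht : ContinuousOn t D) (hm : ContinuousOn m D)
    (hf : ContinuousOn f D) (hfD : MapsTo f D (spread n)) (hl0 : ∀ a ∈ D, 0 < l a) :
    ContinuousOn (fun a => place (l a) (t a) (m a) (f a)) D := by
  have hw : ContinuousOn (fun a => width (f a)) D := continuous_width.comp_continuousOn hf
  have hw0 : ∀ a ∈ D, width (f a) ≠ 0 := fun a ha => (width_pos (hfD ha)).ne'
  have hth : ContinuousOn (fun a => tilt (f a)) D := continuousOn_tilt.comp hf hfD
  refine continuous_deform.comp_continuousOn (f := fun a =>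
    ((Real.log (l a / width (f a)), (t a - tilt (f a)) / width (f a), m a - height (f a)), f a)) ?_
  refine ContinuousOn.prodMk (ContinuousOn.prodMk ?_ (ContinuousOn.prodMk ?_ ?_)) hf
  · exact (hl.div hw hw0).log fun a ha => (div_pos (hl0 a ha) (width_pos (hfD ha))).ne'
  · exact (ht.sub hth).div hw hw0
  · exact hm.sub (continuous_height.comp_continuousOn hf)

end place

/-- The smallest width that a configuration in the closed chamber with given tilt and thickness
can have. -/
noncomputable def edge (k t d : ℝ) : ℝ := k * t + √((k ^ 2 + 1) * t ^ 2 + d)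

@[fun_prop]
theorem continuous_edge (k : ℝ) : Continuous fun p : ℝ × ℝ => edge k p.1 p.2 := by
  unfold edge; fun_prop

/-- `edge k t d` is the larger root in `l` of the quadratic on the right. The product of the roots
is `-(d + t ^ 2) ≤ 0`, so for positive `l` the smaller root imposes no condition. -/
theorem edge_le_iff {k l t d : ℝ} (hl : 0 < l) (hd : 0 ≤ d) :
    edge k t d ≤ l ↔ 0 ≤ l ^ 2 - (d + t ^ 2) - 2 * k * (l * t) := by
  have hD : 0 ≤ (k ^ 2 + 1) * t ^ 2 + d := by positivity
  unfold edge
  rw [← le_sub_iff_add_le', Real.sqrt_le_iff]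
  constructor
  · rintro ⟨-, h⟩; nlinarith
  · intro h
    refine ⟨?_, by nlinarith⟩
    by_contra! hc
    have : l * (l - 2 * (k * t)) < 0 := mul_neg_of_pos_of_neg hl (by linarith)
    nlinarith [sq_nonneg t]

theorem edge_lt_iff {k l t d : ℝ} (hl : 0 < l) (hd : 0 ≤ d) :
    edge k t d < l ↔ 0 < l ^ 2 - (d + t ^ 2) - 2 * k * (l * t) := by
  have hD : 0 ≤ (k ^ 2 + 1) * t ^ 2 + d := by positivity
  unfold edge
  constructor
  · intro h
    have h' : √((k ^ 2 + 1) * t ^ 2 + d) < l - k * t := by linarith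
    have := (Real.sqrt_lt' (lt_of_le_of_lt (Real.sqrt_nonneg _) h')).1 h'
    nlinarith
  · intro h
    have hc : 0 < l - k * t := by
      by_contra! hc
      have : l * (l - 2 * (k * t)) < 0 := mul_neg_of_pos_of_neg hl (by linarith)
      nlinarith [sq_nonneg t]
    have := (Real.sqrt_lt' (x := (k ^ 2 + 1) * t ^ 2 + d) hc).2 (by nlinarith)
    linarith

theorem edge_mono {k t t' d : ℝ} (hk : 0 ≤ k) (ht : 0 ≤ t) (h : t ≤ t') :
    edge k t d ≤ edge k t' d := by
  unfold edge; gcongr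

/-- The open chamber. With `k = cot (π / 2n)` it consists of the configurations for which the
second central moment has argument between `0` and `π / 2n` and the centre of mass lies above the
real line. -/
def chamber (n : ℕ) (k : ℝ) : Set (UConf n) :=
  {x | 0 < momMix x ∧ 0 < momRe x - momIm x - 2 * k * momMix x ∧ 0 < height x}

/-- The closed chamber. -/
def closedChamber (n : ℕ) (k : ℝ) : Set (UConf n) :=
  {x | 0 ≤ momMix x ∧ 0 ≤ momRe x - momIm x - 2 * k * momMix x ∧ 0 ≤ height x}

theorem isOpen_chamber (k : ℝ) : IsOpen (chamber n k) :=
  (isOpen_lt continuous_const continuous_momMix).and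
    ((isOpen_lt continuous_const (g := fun x : UConf n => momRe x - momIm x - 2 * k * momMix x)
      (by fun_prop)).and (isOpen_lt continuous_const continuous_height))

theorem isClosed_closedChamber (k : ℝ) : IsClosed (closedChamber n k) :=
  (isClosed_le continuous_const continuous_momMix).and
    ((isClosed_le continuous_const (g := fun x : UConf n => momRe x - momIm x - 2 * k * momMix x)
      (by fun_prop)).and (isClosed_le continuous_const continuous_height))

theorem chamber_subset (k : ℝ) : chamber n k ⊆ closedChamber n k :=
  fun _ hx => ⟨hx.1.le, hx.2.1.le, hx.2.2.le⟩

section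

variable {k : ℝ} {x : UConf n}

theorem closedChamber_subset_spread (hn : 2 ≤ n) (hk : 0 ≤ k) : closedChamber n k ⊆ spread n := by
  intro x hx
  have h1 := momRe_add_momIm_pos hn x
  have h2 := mul_nonneg hk hx.1
  have h3 := hx.2.1
  change 0 < momRe x
  linarith

theorem mem_closedChamber_iff (hx : x ∈ spread n) : x ∈ closedChamber n k ↔
    0 ≤ tilt x ∧ edge k (tilt x) (thick x) ≤ width x ∧ 0 ≤ height x := by
  have hw := width_pos hx
  have e1 : 0 ≤ momMix x ↔ 0 ≤ tilt x := by
    rw [← width_mul_tilt hx]; exact mul_nonneg_iff_of_pos_left hw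
  have e2 : momRe x - momIm x - 2 * k * momMix x =
      width x ^ 2 - (thick x + tilt x ^ 2) - 2 * k * (width x * tilt x) := by
    rw [width_sq, width_mul_tilt hx, thick]; ring
  change 0 ≤ momMix x ∧ _ ↔ _
  rw [e1, e2]
  exact and_congr_right fun _ => by rw [edge_le_iff hw (thick_nonneg hx)]

theorem mem_chamber_iff (hx : x ∈ spread n) : x ∈ chamber n k ↔
    0 < tilt x ∧ edge k (tilt x) (thick x) < width x ∧ 0 < height x := by
  have hw := width_pos hx
  have e1 : 0 < momMix x ↔ 0 < tilt x := by
    rw [← width_mul_tilt hx]; exact mul_pos_iff_of_pos_left hw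
  have e2 : momRe x - momIm x - 2 * k * momMix x =
      width x ^ 2 - (thick x + tilt x ^ 2) - 2 * k * (width x * tilt x) := by
    rw [width_sq, width_mul_tilt hx, thick]; ring
  change 0 < momMix x ∧ _ ↔ _
  rw [e1, e2]
  exact and_congr_right fun _ => by rw [edge_lt_iff hw (thick_nonneg hx)]

/-- The width reached by the straight homotopy to the closed chamber at time `s`. -/
noncomputable def slideWidth (k s : ℝ) (x : UConf n) : ℝ :=
  (1 - s) * width x + s * max (width x) (edge k (max (tilt x) 0) (thick x))

/-- The straight homotopy to the closed chamber. -/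
noncomputable def slide (k s : ℝ) (x : UConf n) : UConf n :=
  place (slideWidth k s x) ((1 - s) * tilt x + s * max (tilt x) 0)
    ((1 - s) * height x + s * max (height x) 0) x

theorem slideWidth_pos (hx : x ∈ spread n) {s : ℝ} (hs : s ∈ Icc (0 : ℝ) 1) :
    0 < slideWidth k s x := by
  have h1 : s * width x ≤ s * max (width x) (edge k (max (tilt x) 0) (thick x)) :=
    mul_le_mul_of_nonneg_left (le_max_left _ _) hs.1
  have := width_pos hx
  unfold slideWidth
  linarith

theorem slide_mem_spread (hn : n ≠ 0) (hx : x ∈ spread n) {s : ℝ} (hs : s ∈ Icc (0 : ℝ) 1) :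
    slide k s x ∈ spread n := place_mem hn hx (slideWidth_pos hx hs)

theorem slide_zero (hx : x ∈ spread n) : slide k 0 x = x := by
  simp only [slide, slideWidth, sub_zero, one_mul, zero_mul, add_zero, place_self hx]

theorem slide_one_mem (hn : n ≠ 0) (hx : x ∈ spread n) : slide k 1 x ∈ closedChamber n k := by
  have h1 : (1 : ℝ) ∈ Icc (0 : ℝ) 1 := by simp
  have hl := slideWidth_pos (k := k) hx h1
  rw [mem_closedChamber_iff (slide_mem_spread hn hx h1), slide, width_place hn hx hl,
    tilt_place hn hx hl, thick_place hn hx hl, height_place hn]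
  simp [slideWidth]

theorem slide_of_mem (hx : x ∈ spread n) (h : x ∈ closedChamber n k) (s : ℝ) : slide k s x = x := by
  obtain ⟨h1, h2, h3⟩ := (mem_closedChamber_iff hx).1 h
  have e : ∀ a : ℝ, (1 - s) * a + s * a = a := fun a => by ring
  simp only [slide, slideWidth, max_eq_left h1, max_eq_left h2, max_eq_left h3, e, place_self hx]

/-- Moving towards the maximum does not change the maximum, so the target of `slide` is constant
along a track. -/
theorem mix_max_left (a b s : ℝ) (hs : s ∈ Icc (0 : ℝ) 1) :
    max ((1 - s) * a + s * max a b) b = max a b := by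
  rcases le_total a b with h | h
  · rw [max_eq_right h]
    refine max_eq_right ?_
    nlinarith [hs.2]
  · rw [max_eq_left h, show (1 - s) * a + s * a = a by ring, max_eq_left h]

/-- Target and thickness are constant along a track, so two linear interpolations compose to one;
the remaining fraction is `(1 - s) * (1 - s')`. -/
theorem slide_slide (hn : n ≠ 0) (hx : x ∈ spread n) {s s' : ℝ} (hs : s ∈ Icc (0 : ℝ) 1)
    (hs' : s' ∈ Icc (0 : ℝ) 1) : slide k s' (slide k s x) = slide k (s + s' - s * s') x := by
  have hl := slideWidth_pos (k := k) hx hs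
  have hx' := slide_mem_spread (k := k) hn hx hs
  have hl' := slideWidth_pos (k := k) hx' hs'
  have hw : width (slide k s x) = slideWidth k s x := width_place hn hx hl
  have ht : tilt (slide k s x) = _ := tilt_place hn hx hl
  have hd : thick (slide k s x) = _ := thick_place hn hx hl
  have hh : height (slide k s x) = _ := height_place hn
  rw [slide, slide, place_place hn hx hl (by rwa [slide] at hl'), ← slide]
  have e : ∀ a b : ℝ, (1 - s') * ((1 - s) * a + s * b) + s' * b =
    (1 - (s + s' - s * s')) * a + (s + s' - s * s') * b := fun a b => by ring
  rw [slideWidth, hw, ht, hd, hh, mix_max_left _ _ s hs, mix_max_left _ _ s hs, slideWidth,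
    mix_max_left _ _ s hs, e, e, e]
  rfl

/-- A quantity below its bound is raised at most to the bound, so no strict inequality can arise
that did not hold before. For the width this uses that a positive tilt is not moved, which keeps the
bound `edge` fixed. -/
theorem slide_notMem_chamber (hn : n ≠ 0) (hx : x ∈ spread n) (h : x ∉ chamber n k) {s : ℝ}
    (hs : s ∈ Icc (0 : ℝ) 1) : slide k s x ∉ chamber n k := by
  have hl := slideWidth_pos (k := k) hx hs
  rw [mem_chamber_iff (slide_mem_spread hn hx hs), slide, width_place hn hx hl,
    tilt_place hn hx hl, thick_place hn hx hl, height_place hn]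
  rw [mem_chamber_iff hx] at h
  contrapose! h
  obtain ⟨h1, h2, h3⟩ := h
  have key : ∀ a : ℝ, 0 < (1 - s) * a + s * max a 0 → 0 < a := fun a ha => by
    by_contra! hc
    rw [max_eq_right hc] at ha
    nlinarith [hs.2]
  have ht := key _ h1
  refine ⟨ht, ?_, key _ h3⟩
  by_contra! hc
  rw [slideWidth, max_eq_left ht.le, max_eq_right hc] at h2
  rw [show (1 - s) * tilt x + s * tilt x = tilt x by ring] at h2
  nlinarith [hs.2]

theorem continuousOn_slide (k : ℝ) : ContinuousOn (fun p : ℝ × UConf n => slide k p.1 p.2)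
    (Icc 0 1 ×ˢ spread n) := by
  have h2 : ContinuousOn (fun p : ℝ × UConf n => p.2) (Icc 0 1 ×ˢ spread n) :=
    continuous_snd.continuousOn
  have hm : MapsTo (fun p : ℝ × UConf n => p.2) (Icc 0 1 ×ˢ spread n) (spread n) := fun p hp => hp.2
  have ht : ContinuousOn (fun p : ℝ × UConf n => tilt p.2) (Icc 0 1 ×ˢ spread n) :=
    continuousOn_tilt.comp h2 hm
  have hd : ContinuousOn (fun p : ℝ × UConf n => thick p.2) (Icc 0 1 ×ˢ spread n) :=
    continuousOn_thick.comp h2 hm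
  have he : ContinuousOn (fun p : ℝ × UConf n => edge k (max (tilt p.2) 0) (thick p.2))
      (Icc 0 1 ×ˢ spread n) :=
    (continuous_edge k).comp_continuousOn
      (f := fun p : ℝ × UConf n => (max (tilt p.2) 0, thick p.2))
      ((ht.sup continuousOn_const).prodMk hd)
  refine continuousOn_place ?_ ?_ ?_ h2 hm fun p hp => slideWidth_pos hp.2 hp.1
  · have hw : ContinuousOn (fun p : ℝ × UConf n => width p.2) (Icc 0 1 ×ˢ spread n) := by fun_prop
    exact (ContinuousOn.mul (by fun_prop) hw).add (continuous_fst.continuousOn.mul (hw.sup he))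
  · exact (ContinuousOn.mul (by fun_prop) ht).add
      (continuous_fst.continuousOn.mul (ht.sup continuousOn_const))
  · fun_prop

/-- The width of `push`. -/
noncomputable def pushWidth (k s : ℝ) (x : UConf n) : ℝ :=
  width x + edge k (tilt x + s) (thick x) - edge k (tilt x) (thick x) + s

/-- For positive `s`, a deformation that moves the closed chamber into the open one. -/
noncomputable def push (k s : ℝ) (x : UConf n) : UConf n :=
  place (pushWidth k s x) (tilt x + s) (height x + s) x

theorem push_zero (hx : x ∈ spread n) : push k 0 x = x := by
  simp only [push, pushWidth, add_zero, add_sub_cancel_right, place_self hx]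

theorem pushWidth_pos (hk : 0 ≤ k) (hx : x ∈ spread n) (h : x ∈ closedChamber n k) {s : ℝ}
    (hs : 0 ≤ s) : 0 < pushWidth k s x := by
  have h' := (mem_closedChamber_iff hx).1 h
  have := edge_mono (d := thick x) hk h'.1 (show tilt x ≤ tilt x + s by linarith)
  have := width_pos hx
  unfold pushWidth
  linarith

theorem push_mem_chamber (hn : n ≠ 0) (hk : 0 ≤ k) (hx : x ∈ spread n)
    (h : x ∈ closedChamber n k) {s : ℝ} (hs : 0 < s) : push k s x ∈ chamber n k := by
  have hl := pushWidth_pos hk hx h hs.le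
  obtain ⟨h1, h2, h3⟩ := (mem_closedChamber_iff hx).1 h
  rw [push, mem_chamber_iff (place_mem hn hx hl), width_place hn hx hl,
    tilt_place hn hx hl, thick_place hn hx hl, height_place hn]
  refine ⟨by linarith, ?_, by linarith⟩
  unfold pushWidth
  linarith

/-- `push` changes the margin in each of the three inequalities by exactly `s`. A negative `s`
therefore turns a nonpositive margin into a negative one. -/
theorem push_notMem_closedChamber (hn : n ≠ 0) (hx : x ∈ spread n) (h : x ∉ chamber n k) {s : ℝ}
    (hs : s < 0) (hl : 0 < pushWidth k s x) : push k s x ∉ closedChamber n k := by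
  rw [push, mem_closedChamber_iff (place_mem hn hx hl), width_place hn hx hl,
    tilt_place hn hx hl, thick_place hn hx hl, height_place hn]
  rintro ⟨h1, h2, h3⟩
  unfold pushWidth at h2
  exact h ((mem_chamber_iff hx).2 ⟨by linarith, by linarith, by linarith⟩)

theorem continuous_pushWidth (x : UConf n) : Continuous fun s => pushWidth k s x := by
  have : Continuous fun s : ℝ => edge k (tilt x + s) (thick x) :=
    (continuous_edge k).comp (by fun_prop : Continuous fun s : ℝ => (tilt x + s, thick x))
  unfold pushWidth
  fun_prop

theorem continuousAt_push (hx : x ∈ spread n) : ContinuousAt (fun s => push k s x) 0 := by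
  have h0 : 0 < pushWidth k 0 x := by simpa [pushWidth] using width_pos hx
  have hopen : IsOpen {s | 0 < pushWidth k s x} :=
    isOpen_lt continuous_const (continuous_pushWidth x)
  refine ContinuousOn.continuousAt (s := {s | 0 < pushWidth k s x}) ?_ (hopen.mem_nhds h0)
  exact continuousOn_place (continuous_pushWidth x).continuousOn (by fun_prop) (by fun_prop)
    continuousOn_const (fun _ _ => hx) fun s hs => hs

theorem continuousOn_push (hk : 0 ≤ k) : ContinuousOn (fun p : ℝ × UConf n => push k p.1 p.2)
    (Ici 0 ×ˢ (closedChamber n k ∩ spread n)) := by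
  set D : Set (ℝ × UConf n) := Ici 0 ×ˢ (closedChamber n k ∩ spread n)
  have h2 : ContinuousOn (fun p : ℝ × UConf n => p.2) D := continuous_snd.continuousOn
  have hm : MapsTo (fun p : ℝ × UConf n => p.2) D (spread n) := fun p hp => hp.2.2
  have ht : ContinuousOn (fun p : ℝ × UConf n => tilt p.2) D := continuousOn_tilt.comp h2 hm
  have hd : ContinuousOn (fun p : ℝ × UConf n => thick p.2) D := continuousOn_thick.comp h2 hm
  have hs : ContinuousOn (fun p : ℝ × UConf n => p.1) D := continuous_fst.continuousOn
  refine continuousOn_place ?_ (ht.add hs) (by fun_prop) h2 hm fun p hp =>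
    pushWidth_pos hk hp.2.2 hp.2.1 hp.1
  have hw : ContinuousOn (fun p : ℝ × UConf n => width p.2) D := by fun_prop
  have he1 : ContinuousOn (fun p : ℝ × UConf n => edge k (tilt p.2 + p.1) (thick p.2)) D :=
    (continuous_edge k).comp_continuousOn
      (f := fun p : ℝ × UConf n => (tilt p.2 + p.1, thick p.2)) ((ht.add hs).prodMk hd)
  have he2 : ContinuousOn (fun p : ℝ × UConf n => edge k (tilt p.2) (thick p.2)) D :=
    (continuous_edge k).comp_continuousOn
      (f := fun p : ℝ × UConf n => (tilt p.2, thick p.2)) (ht.prodMk hd)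
  exact ((hw.add he1).sub he2).add hs

/-- A point of the closed chamber is the limit of its pushes as `s` decreases to 0, and these lie in
the open chamber. -/
theorem closure_chamber (hn : 2 ≤ n) (hk : 0 ≤ k) : closure (chamber n k) = closedChamber n k := by
  refine subset_antisymm (closure_minimal (chamber_subset k) (isClosed_closedChamber k)) ?_
  intro x h
  have hx := closedChamber_subset_spread hn hk h
  have hc : Filter.Tendsto (fun s => push k s x) (𝓝[>] 0) (𝓝 x) := by
    have := (continuousAt_push (k := k) hx).tendsto
    rw [push_zero hx] at this
    exact this.mono_left nhdsWithin_le_nhds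
  refine mem_closure_of_tendsto hc ?_
  filter_upwards [self_mem_nhdsWithin] with s hs
  exact push_mem_chamber (by omega) hk hx h hs

/-- The limit is now taken over negative `s`, close enough to 0 for the width to remain positive. -/
theorem boundary_subset (hn : 2 ≤ n) (hk : 0 ≤ k) :
    closedChamber n k \ chamber n k ⊆ closure (closedChamber n k)ᶜ := by
  rintro x ⟨h, hc⟩
  have hx := closedChamber_subset_spread hn hk h
  have ht : Filter.Tendsto (fun s => push k s x) (𝓝[<] 0) (𝓝 x) := by
    have := (continuousAt_push (k := k) hx).tendsto
    rw [push_zero hx] at this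
    exact this.mono_left nhdsWithin_le_nhds
  refine mem_closure_of_tendsto ht ?_
  have h0 : 0 < pushWidth k 0 x := by simpa [pushWidth] using width_pos hx
  filter_upwards [self_mem_nhdsWithin, mem_nhdsWithin_of_mem_nhds
    ((isOpen_lt continuous_const (continuous_pushWidth (k := k) x)).mem_nhds h0)] with s hs hs'
  exact push_notMem_closedChamber (by omega) hx hc hs hs'

end

end UConf

/-! ### Path connectedness, and the thickening -/

namespace UConf

open Topology Set

variable {n : ℕ}

theorem joinedIn_mk {A : Set (UConf n)} {f : ℝ → Fin n → ℂ} (hf : Continuous f)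
    (hinj : ∀ t ∈ Icc (0 : ℝ) 1, Function.Injective (f t))
    (hA : ∀ t (ht : t ∈ Icc (0 : ℝ) 1), mk ⟨f t, hinj t ht⟩ ∈ A) :
    JoinedIn A (mk ⟨f 0, hinj 0 (by simp)⟩) (mk ⟨f 1, hinj 1 (by simp)⟩) := by
  refine ⟨⟨⟨fun t => mk ⟨f t, hinj t t.2⟩, continuous_mk.comp
    (Continuous.subtype_mk (hf.comp continuous_subtype_val) _)⟩, ?_, ?_⟩, fun t => hA t t.2⟩
  · rfl
  · rfl

theorem continuous_complex_mk {A : Type*} [TopologicalSpace A] {f g : A → ℝ} (hf : Continuous f)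
    (hg : Continuous g) : Continuous fun a => (⟨f a, g a⟩ : ℂ) :=
  Complex.equivRealProdCLM.symm.continuous.comp (hf.prodMk hg)

theorem realPoints_nonempty : (realPoints n).Nonempty :=
  ⟨_, ⟨fun i => ((i : ℕ) : ℂ), fun i j h => Fin.ext (Nat.cast_injective h)⟩, fun i => by simp, rfl⟩

/-- A configuration of real points has an increasing labelling. -/
theorem exists_strictMono_of_mem_realPoints {x : UConf n} (hx : x ∈ realPoints n) :
    ∃ z : OConf n, (∀ i, (z.1 i).im = 0) ∧ StrictMono (fun i => (z.1 i).re) ∧ mk z = x := by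
  obtain ⟨z, hz, rfl⟩ := hx
  let σ := Tuple.sort fun i => (z.1 i).re
  refine ⟨relabel σ z, fun i => hz _, ?_, (mk_eq σ fun i => rfl).symm⟩
  refine (Tuple.monotone_sort fun i => (z.1 i).re).strictMono_of_injective ?_
  intro i j h
  exact σ.injective (z.2 (Complex.ext h ((hz _).trans (hz _).symm)))

/-- Convex combinations of two increasing labellings are increasing, hence injective. -/
theorem isPathConnected_realPoints : IsPathConnected (realPoints n) := by
  refine isPathConnected_iff.2 ⟨realPoints_nonempty, fun x hx y hy => ?_⟩
  obtain ⟨z, hz, hzm, rfl⟩ := exists_strictMono_of_mem_realPoints hx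
  obtain ⟨w, hw, hwm, rfl⟩ := exists_strictMono_of_mem_realPoints hy
  let f : ℝ → Fin n → ℂ := fun t i => ⟨(1 - t) * (z.1 i).re + t * (w.1 i).re, 0⟩
  have hf : Continuous f := continuous_pi fun i => continuous_complex_mk (by fun_prop) (by fun_prop)
  have hinj : ∀ t ∈ Icc (0 : ℝ) 1, Function.Injective (f t) := by
    intro t ht
    have hmono : StrictMono fun i => (f t i).re := by
      intro i j hij
      have h1 : (z.1 i).re < (z.1 j).re := hzm hij
      have h2 : (w.1 i).re < (w.1 j).re := hwm hij
      change (1 - t) * (z.1 i).re + t * (w.1 i).re < (1 - t) * (z.1 j).re + t * (w.1 j).re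
      rcases ht.1.eq_or_lt with h | h
      · subst h; linarith
      · nlinarith [ht.2, mul_lt_mul_of_pos_left h2 h]
    exact fun i j h => hmono.injective (congrArg Complex.re h)
  have hj := joinedIn_mk (A := realPoints n) hf hinj fun t ht => ⟨_, fun i => rfl, rfl⟩
  have e0 : (⟨f 0, hinj 0 (by simp)⟩ : OConf n) = z :=
    Subtype.ext (funext fun i => Complex.ext (by simp [f]) (hz i).symm)
  have e1 : (⟨f 1, hinj 1 (by simp)⟩ : OConf n) = w :=
    Subtype.ext (funext fun i => Complex.ext (by simp [f]) (hw i).symm)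
  rwa [e0, e1] at hj

theorem isPathConnected_of_joinedIn_real {A : Set (UConf n)} (hA : realPoints n ⊆ A)
    (h : ∀ x ∈ A, ∃ y ∈ realPoints n, JoinedIn A x y) : IsPathConnected A := by
  refine isPathConnected_iff.2 ⟨realPoints_nonempty.mono hA, fun x hx y hy => ?_⟩
  obtain ⟨x', hx', jx⟩ := h x hx
  obtain ⟨y', hy', jy⟩ := h y hy
  exact jx.trans (((isPathConnected_realPoints.joinedIn x' hx' y' hy').mono hA).trans jy.symm)

/-- Shear the real parts with slope `s` and scale the imaginary parts by `r`. -/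
def squeeze (s r : ℝ) (z : Fin n → ℂ) (i : Fin n) : ℂ := ⟨(z i).re + s * (z i).im, r * (z i).im⟩

theorem squeeze_mean (s r : ℝ) (z : Fin n → ℂ) :
    (mean (squeeze s r z)).re = (mean z).re + s * (mean z).im ∧
      (mean (squeeze s r z)).im = r * (mean z).im := by
  simp only [mean_re, mean_im, squeeze, Finset.sum_add_distrib, ← Finset.mul_sum]
  constructor <;> ring

theorem squeeze_rel (s r : ℝ) (z : Fin n → ℂ) (i : Fin n) :
    relRe (squeeze s r z) i = relRe z i + s * relIm z i ∧
      relIm (squeeze s r z) i = r * relIm z i := by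
  simp only [relRe, relIm, squeeze_mean]
  simp only [squeeze]
  constructor <;> ring

theorem moments_squeeze (s r : ℝ) (z w : OConf n) (h : w.1 = squeeze s r z.1) :
    momRe (mk w) = momRe (mk z) + 2 * s * momMix (mk z) + s ^ 2 * momIm (mk z) ∧
    momMix (mk w) = r * (momMix (mk z) + s * momIm (mk z)) ∧
    momIm (mk w) = r ^ 2 * momIm (mk z) ∧ height (mk w) = r * height (mk z) := by
  simp only [momRe_mk, momMix_mk, momIm_mk, height_mk, h, squeeze_rel, squeeze_mean,
    Finset.mul_sum, ← Finset.sum_add_distrib]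
  refine ⟨?_, ?_, ?_, trivial⟩ <;> exact Finset.sum_congr rfl fun i _ => by ring

theorem squeeze_injective_of_ne_zero (s : ℝ) {r : ℝ} (hr : r ≠ 0) {z : Fin n → ℂ}
    (hz : Function.Injective z) : Function.Injective (squeeze s r z) := by
  intro i j h
  obtain ⟨h1, h2⟩ := Complex.mk.inj h
  have h2' := mul_left_cancel₀ hr h2
  rw [h2'] at h1
  exact hz (Complex.ext (add_right_cancel h1) h2')

/-- A small shear makes the real parts distinct. -/
theorem exists_shear_injective (z : OConf n) {e : ℝ} (he : 0 < e) :
    ∃ s ∈ Ioo 0 e, Function.Injective fun i => (z.1 i).re + s * (z.1 i).im := by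
  -- Two distinct points acquire equal real parts for at most one slope, so only finitely many
  -- slopes are excluded.
  have hfin : (⋃ i : Fin n, ⋃ j : Fin n,
      {s : ℝ | i ≠ j ∧ (z.1 i).re + s * (z.1 i).im = (z.1 j).re + s * (z.1 j).im}).Finite := by
    refine finite_iUnion fun i => finite_iUnion fun j => Set.Subsingleton.finite ?_
    rintro s ⟨hij, hs⟩ s' ⟨-, hs'⟩
    by_contra hne
    have him : (z.1 i).im = (z.1 j).im := by
      have : (s - s') * ((z.1 i).im - (z.1 j).im) = 0 := by linarith
      rcases mul_eq_zero.1 this with h | h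
      · exact absurd (sub_eq_zero.1 h) hne
      · exact sub_eq_zero.1 h
    rw [him] at hs
    exact hij (z.2 (Complex.ext (add_right_cancel hs) him))
  obtain ⟨s, hs, hns⟩ := (Ioo_infinite he).exists_notMem_finite hfin
  refine ⟨s, hs, fun i j h => ?_⟩
  by_contra hij
  exact hns (mem_iUnion.2 ⟨i, mem_iUnion.2 ⟨j, hij, h⟩⟩)

/-- A set that contains the small shears of a configuration and their contractions towards the
real line contains a path from the configuration to a real one. -/
theorem exists_joinedIn_real {A : Set (UConf n)} (z : OConf n) {e : ℝ} (he : 0 < e)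
    (hA : ∀ s ∈ Icc 0 e, ∀ r ∈ Icc (0 : ℝ) 1, ∀ w : OConf n, w.1 = squeeze s r z.1 → mk w ∈ A) :
    ∃ y ∈ realPoints n, JoinedIn A (mk z) y := by
  obtain ⟨s, hs, hinj⟩ := exists_shear_injective z he
  have i1 : ∀ t ∈ Icc (0 : ℝ) 1, Function.Injective (squeeze (t * s) 1 z.1) := fun t _ =>
    squeeze_injective_of_ne_zero _ one_ne_zero z.2
  have i2 : ∀ t ∈ Icc (0 : ℝ) 1, Function.Injective (squeeze s (1 - t) z.1) := fun t _ i j h =>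
    hinj (congrArg Complex.re h)
  have j1 : JoinedIn A _ _ := joinedIn_mk (A := A) (f := fun t => squeeze (t * s) 1 z.1)
    (continuous_pi fun i => continuous_complex_mk (by fun_prop) (by fun_prop)) i1
    fun t ht => hA (t * s) ⟨by nlinarith [ht.1, hs.1], by nlinarith [ht.2, hs.1, hs.2]⟩ 1
      (by simp) _ rfl
  have j2 : JoinedIn A _ _ := joinedIn_mk (A := A) (f := fun t => squeeze s (1 - t) z.1)
    (continuous_pi fun i => continuous_complex_mk (by fun_prop) (by fun_prop)) i2
    fun t ht => hA s ⟨hs.1.le, hs.2.le⟩ (1 - t) ⟨by linarith [ht.2], by linarith [ht.1]⟩ _ rfl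
  have e0 : (⟨squeeze (0 * s) 1 z.1, i1 0 (by simp)⟩ : OConf n) = z :=
    Subtype.ext (funext fun i => Complex.ext (by simp [squeeze]) (by simp [squeeze]))
  have e1 : (⟨squeeze (1 * s) 1 z.1, i1 1 (by simp)⟩ : OConf n) =
      ⟨squeeze s (1 - 0) z.1, i2 0 (by simp)⟩ :=
    Subtype.ext (by change squeeze (1 * s) 1 z.1 = squeeze s (1 - 0) z.1; rw [one_mul, sub_zero])
  rw [e0, e1] at j1
  exact ⟨_, ⟨_, fun i => by simp [squeeze], rfl⟩, j1.trans j2⟩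

theorem moments_of_mem_realPoints {x : UConf n} (hx : x ∈ realPoints n) :
    momMix x = 0 ∧ momIm x = 0 ∧ height x = 0 := by
  obtain ⟨z, hz, rfl⟩ := hx
  have hm : (mean z.1).im = 0 := by rw [mean_im]; simp [hz]
  have hy : ∀ i, relIm z.1 i = 0 := fun i => by rw [relIm, hz, hm, sub_zero]
  rw [momMix_mk, momIm_mk, height_mk, hm]
  simp [hy]

theorem realPoints_subset_closedChamber (k : ℝ) : realPoints n ⊆ closedChamber n k := by
  intro x hx
  obtain ⟨h1, h2, h3⟩ := moments_of_mem_realPoints hx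
  have := momRe_nonneg x
  refine ⟨h1.ge, ?_, h3.ge⟩
  rw [h1, h2]; linarith

theorem realPoints_subset_compl_chamber (k : ℝ) : realPoints n ⊆ (chamber n k)ᶜ := fun _ hx h =>
  h.1.ne' (moments_of_mem_realPoints hx).1

section

variable {k : ℝ} {x : UConf n}

theorem continuous_deform_comp {s r t : ℝ → ℝ} (hs : Continuous s) (hr : Continuous r)
    (ht : Continuous t) (x : UConf n) : Continuous fun a => deform (s a) (r a) (t a) x :=
  continuous_deform.comp (f := fun a => ((s a, r a, t a), x)) (by fun_prop)

/-- A shear can violate the sector inequality on the wall where it is an equality. Stretching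
horizontally first makes it strict, and then a small shear followed by flattening stays in the
closed chamber. -/
theorem exists_joinedIn_of_height_eq_zero (hn : 2 ≤ n) (hk : 0 ≤ k) (h : x ∈ closedChamber n k)
    (h0 : height x = 0) :
    ∃ y ∈ realPoints n, JoinedIn (closedChamber n k ∩ {x | height x = 0}) x y := by
  have hn' : n ≠ 0 := by omega
  have hx : 0 < momRe x := closedChamber_subset_spread hn hk h
  have hc := momIm_nonneg x
  obtain ⟨hb, hg, -⟩ := h
  -- With a, b, c the moments `momRe`, `momMix`, `momIm` of `x`, the difference of the two sides is
  -- `exp t` times (a - c - 2kb) plus (`exp t` - 1) times c.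
  have hgap : ∀ t : ℝ, 0 ≤ t → Real.exp t * (Real.exp t - 1) * momRe x ≤
      momRe (deform t 0 0 x) - momIm (deform t 0 0 x) - 2 * k * momMix (deform t 0 0 x) := by
    intro t ht
    rw [momRe_deform hn', momIm_deform hn', momMix_deform hn']
    have h1 : 1 ≤ Real.exp t := Real.one_le_exp ht
    have h2 := mul_nonneg (by linarith : 0 ≤ Real.exp t) hg
    have h3 := mul_nonneg (by linarith : 0 ≤ Real.exp t - 1) hc
    linarith
  have j1 : JoinedIn (closedChamber n k ∩ {x | height x = 0}) x (deform 1 0 0 x) := by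
    refine JoinedIn.ofLine (f := fun t => deform t 0 0 x)
      (continuous_deform_comp continuous_id continuous_const continuous_const x).continuousOn
      (deform_zero x) rfl ?_
    rintro _ ⟨t, ht, rfl⟩
    have h1 : 1 ≤ Real.exp t := Real.one_le_exp ht.1
    refine ⟨⟨?_, le_trans ?_ (hgap t ht.1), ?_⟩, ?_⟩
    · rw [momMix_deform hn', zero_mul, add_zero]; positivity
    · have : 0 ≤ Real.exp t - 1 := by linarith
      positivity
    · rw [height_deform hn', h0, add_zero]
    · change height _ = 0
      rw [height_deform hn', h0, add_zero]
  have hy := j1.target_mem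
  have hG : 0 < momRe (deform 1 0 0 x) - momIm (deform 1 0 0 x) -
      2 * k * momMix (deform 1 0 0 x) := by
    refine lt_of_lt_of_le ?_ (hgap 1 zero_le_one)
    have : 0 < Real.exp 1 - 1 := by linarith [Real.one_lt_exp_iff.2 one_pos]
    positivity
  generalize deform 1 0 0 x = y at j1 hy hG
  obtain ⟨⟨hyb, -, -⟩, hy0⟩ := hy
  obtain ⟨z, rfl⟩ := mk_surjective y
  have hyc := momIm_nonneg (mk z)
  set G := momRe (mk z) - momIm (mk z) - 2 * k * momMix (mk z) with hGdef
  have hD : 0 < 2 * k * momIm (mk z) + 1 := by positivity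
  obtain ⟨y', hy', j2⟩ := exists_joinedIn_real (A := closedChamber n k ∩ {x | height x = 0}) z
    -- Shearing by `s` and flattening reduces the gap `G` by at most `2 * k * s * momIm`; the
    -- summand 1 keeps the denominator positive.
    (e := G / (2 * k * momIm (mk z) + 1)) (div_pos hG hD) (by
      rintro s ⟨hs0, hs⟩ r ⟨hr0, hr1⟩ w hw
      obtain ⟨e1, e2, e3, e4⟩ := moments_squeeze s r z w hw
      have hs' : s * (2 * k * momIm (mk z) + 1) ≤ G := (le_div_iff₀ hD).1 hs
      have hsb : 0 ≤ s * momMix (mk z) := mul_nonneg hs0 hyb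
      have hsc : 0 ≤ s * momIm (mk z) := mul_nonneg hs0 hyc
      have e4' : height (mk w) = 0 := by rw [e4, hy0, mul_zero]
      refine ⟨⟨?_, ?_, e4'.ge⟩, e4'⟩
      · rw [e2]; exact mul_nonneg hr0 (add_nonneg hyb hsc)
      · rw [e1, e2, e3]
        have hr2 : r ^ 2 * momIm (mk z) ≤ momIm (mk z) :=
          mul_le_of_le_one_left hyc (pow_le_one₀ hr0 hr1)
        have hr3 : k * (r * (momMix (mk z) + s * momIm (mk z))) ≤
            k * (momMix (mk z) + s * momIm (mk z)) :=
          mul_le_mul_of_nonneg_left (mul_le_of_le_one_left (add_nonneg hyb hsc) hr1) hk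
        have hs2 : 0 ≤ s ^ 2 * momIm (mk z) := mul_nonneg (sq_nonneg s) hyc
        nlinarith)
  exact ⟨y', hy', j1.trans j2⟩

theorem lower_path (hn : n ≠ 0) {A : Set (UConf n)} (x : UConf n)
    (hA : ∀ y : UConf n, momRe y = momRe x → momMix y = momMix x → momIm y = momIm x →
      (∃ t ∈ Icc (0 : ℝ) 1, height y = (1 - t) * height x) → y ∈ A) :
    ∃ y, JoinedIn A x y ∧ height y = 0 ∧ y ∈ A := by
  have key : ∀ t ∈ Icc (0 : ℝ) 1, deform 0 0 (-t * height x) x ∈ A := fun t ht => by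
    refine hA _ ?_ ?_ ?_ ⟨t, ht, ?_⟩
    · simp [momRe_deform hn]
    · simp [momMix_deform hn]
    · simp [momIm_deform hn]
    · rw [height_deform hn]; ring
  refine ⟨deform 0 0 (-1 * height x) x, ?_, ?_, key 1 (by simp)⟩
  · refine JoinedIn.ofLine (f := fun t => deform 0 0 (-t * height x) x)
      (continuous_deform_comp continuous_const continuous_const (by fun_prop) x).continuousOn
      (by simp [deform_zero]) rfl ?_
    rintro _ ⟨t, ht, rfl⟩
    exact key t ht
  · rw [height_deform hn]; ring

theorem isPathConnected_closedChamber (hn : 2 ≤ n) (hk : 0 ≤ k) :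
    IsPathConnected (closedChamber n k) := by
  refine isPathConnected_of_joinedIn_real (realPoints_subset_closedChamber k) fun x h => ?_
  obtain ⟨y, j, hy0, hy⟩ := lower_path (by omega) (A := closedChamber n k) x (by
    rintro y e1 e2 e3 ⟨t, ht, e4⟩
    refine ⟨e2 ▸ h.1, ?_, ?_⟩
    · rw [e1, e2, e3]; exact h.2.1
    · rw [e4]; exact mul_nonneg (by linarith [ht.2]) h.2.2)
  obtain ⟨w, hw, j'⟩ := exists_joinedIn_of_height_eq_zero hn hk hy hy0
  exact ⟨w, hw, j.trans (j'.mono inter_subset_left)⟩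

theorem notMem_chamber_of_height {y : UConf n} (h : x ∉ chamber n k) (e1 : momRe y = momRe x)
    (e2 : momMix y = momMix x) (e3 : momIm y = momIm x) {t : ℝ} (ht : t ∈ Icc (0 : ℝ) 1)
    (e4 : height y = (1 - t) * height x) : y ∉ chamber n k := by
  rintro ⟨h1, h2, h3⟩
  rw [e2] at h1
  rw [e1, e2, e3] at h2
  rw [e4] at h3
  refine h ⟨h1, h2, ?_⟩
  by_contra! hc
  have : 0 ≤ 1 - t := by linarith [ht.2]
  nlinarith

/-- Points of the closed chamber at height zero are never in the open chamber, so the path built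
there stays in the boundary. -/
theorem isPathConnected_boundary (hn : 2 ≤ n) (hk : 0 ≤ k) :
    IsPathConnected (closedChamber n k \ chamber n k) := by
  refine isPathConnected_of_joinedIn_real (fun x hx => ⟨realPoints_subset_closedChamber k hx,
    realPoints_subset_compl_chamber k hx⟩) fun x h => ?_
  obtain ⟨y, j, hy0, hy⟩ := lower_path (by omega) (A := closedChamber n k \ chamber n k) x (by
    rintro y e1 e2 e3 ⟨t, ht, e4⟩
    refine ⟨⟨e2 ▸ h.1.1, ?_, ?_⟩, notMem_chamber_of_height h.2 e1 e2 e3 ht e4⟩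
    · rw [e1, e2, e3]; exact h.1.2.1
    · rw [e4]; exact mul_nonneg (by linarith [ht.2]) h.1.2.2)
  obtain ⟨w, hw, j'⟩ := exists_joinedIn_of_height_eq_zero hn hk hy.1 hy0
  exact ⟨w, hw, j.trans (j'.mono fun v hv => ⟨hv.1, fun hc => hc.2.2.ne' hv.2⟩)⟩

theorem isPathConnected_compl_chamber (hn : n ≠ 0) : IsPathConnected (chamber n k)ᶜ := by
  refine isPathConnected_of_joinedIn_real (realPoints_subset_compl_chamber k) fun x h => ?_
  obtain ⟨y, j, hy0, hy⟩ := lower_path hn (A := (chamber n k)ᶜ) x (by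
    rintro y e1 e2 e3 ⟨t, ht, e4⟩
    exact notMem_chamber_of_height h e1 e2 e3 ht e4)
  obtain ⟨z, rfl⟩ := mk_surjective y
  obtain ⟨w, hw, j'⟩ := exists_joinedIn_real (A := (chamber n k)ᶜ) z one_pos (by
    intro s _ r _ w hw hc
    have := (moments_squeeze s r z w hw).2.2.2
    rw [hy0, mul_zero] at this
    exact hc.2.2.ne' this)
  exact ⟨w, hw, j.trans j'⟩

/-- `push k 1` maps the connected closed chamber into the open one, and each point of the open
chamber is joined to its image by its own pushes. -/
theorem isPathConnected_chamber (hn : 2 ≤ n) (hk : 0 ≤ k) : IsPathConnected (chamber n k) := by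
  have hs : closedChamber n k ∩ spread n = closedChamber n k :=
    inter_eq_left.2 (closedChamber_subset_spread hn hk)
  have hcont := continuousOn_push (n := n) hk
  rw [hs] at hcont
  have himg : IsPathConnected (push k 1 '' closedChamber n k) := by
    refine (isPathConnected_closedChamber hn hk).image' ?_
    exact hcont.comp (f := fun x => ((1 : ℝ), x)) (by fun_prop) fun x hx => ⟨by simp, hx⟩
  have hmem : ∀ x ∈ closedChamber n k, ∀ s, 0 < s → push k s x ∈ chamber n k := fun x hx s hs =>
    push_mem_chamber (by omega) hk (closedChamber_subset_spread hn hk hx) hx hs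
  have hj : ∀ x ∈ chamber n k, JoinedIn (chamber n k) x (push k 1 x) := by
    intro x hx
    have hx' := chamber_subset k hx
    have hxs := closedChamber_subset_spread hn hk hx'
    refine JoinedIn.ofLine (f := fun s => push k s x) ?_ (push_zero hxs) rfl ?_
    · exact hcont.comp (f := fun s => (s, x)) (by fun_prop) fun s hs => ⟨hs.1, hx'⟩
    · rintro _ ⟨s, hs, rfl⟩
      rcases hs.1.eq_or_lt with h | h
      · subst h; simpa only [push_zero hxs] using hx
      · exact hmem x hx' s h
  have hsub : push k 1 '' closedChamber n k ⊆ chamber n k := by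
    rintro _ ⟨x, hx, rfl⟩; exact hmem x hx 1 one_pos
  refine isPathConnected_iff.2 ⟨himg.nonempty.mono hsub, fun x hx y hy => ?_⟩
  exact (hj x hx).trans (((himg.joinedIn _ (mem_image_of_mem _ (chamber_subset k hx)) _
    (mem_image_of_mem _ (chamber_subset k hy))).mono hsub).trans (hj y hy).symm)

/-- The configurations whose straight path to the closed chamber lies in `N`. -/
def thickening (k : ℝ) (N : Set (UConf n)) : Set (UConf n) :=
  {x | x ∈ spread n ∧ ∀ s ∈ Icc (0 : ℝ) 1, slide k s x ∈ N}

variable {N : Set (UConf n)}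

theorem thickening_subset : thickening k N ⊆ N := fun x hx => by
  have := hx.2 0 (by simp)
  rwa [slide_zero hx.1] at this

theorem closedChamber_subset_thickening (hn : 2 ≤ n) (hk : 0 ≤ k) (hN : closedChamber n k ⊆ N) :
    closedChamber n k ⊆ thickening k N := fun x hx => by
  have hxs := closedChamber_subset_spread hn hk hx
  exact ⟨hxs, fun s _ => by rw [slide_of_mem hxs hx]; exact hN hx⟩

/-- By `slide_slide`, the track of a point on a track is part of the original track. -/
theorem slide_mem_thickening (hn : n ≠ 0) (hx : x ∈ thickening k N) {s : ℝ}
    (hs : s ∈ Icc (0 : ℝ) 1) : slide k s x ∈ thickening k N := by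
  refine ⟨slide_mem_spread hn hx.1 hs, fun s' hs' => ?_⟩
  rw [slide_slide hn hx.1 hs hs']
  refine hx.2 _ ⟨?_, ?_⟩
  · nlinarith [hs.1, hs.2, hs'.1, hs'.2]
  · nlinarith [hs.1, hs.2, hs'.1, hs'.2]

/-- Inside `spread n` the complement is the projection of a closed set along the compact unit
interval, hence closed. -/
theorem isOpen_thickening (hN : IsOpen N) : IsOpen (thickening k N) := by
  have hO : IsOpen {p : unitInterval × spread n | slide k (p.1 : ℝ) (p.2 : UConf n) ∈ N} := by
    refine hN.preimage ?_
    exact (continuousOn_slide k).comp_continuous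
      (f := fun p : unitInterval × spread n => ((p.1 : ℝ), (p.2 : UConf n))) (by fun_prop)
      fun p => ⟨p.1.2, p.2.2⟩
  have hcl := isClosedMap_snd_of_compactSpace (X := unitInterval) (Y := spread n) _
    hO.isClosed_compl
  have e : thickening k N = Subtype.val '' (Prod.snd ''
      {p : unitInterval × spread n | slide k (p.1 : ℝ) (p.2 : UConf n) ∈ N}ᶜ)ᶜ := by
    ext x
    constructor
    · rintro ⟨hx, h⟩
      refine ⟨⟨x, hx⟩, ?_, rfl⟩
      rintro ⟨⟨s, y⟩, hp, rfl⟩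
      exact hp (h s s.2)
    · rintro ⟨y, hy, rfl⟩
      refine ⟨y.2, fun s hs => ?_⟩
      by_contra hc
      exact hy ⟨(⟨s, hs⟩, y), hc, rfl⟩
  rw [e]
  exact isOpen_spread.isOpenMap_subtype_val _ hcl.isOpen_compl

theorem isThickening (hn : 2 ≤ n) (hk : 0 ≤ k) (hN : IsOpen N) (hFN : closedChamber n k ⊆ N) :
    IsThickening (closedChamber n k) (thickening k N) := by
  have hn' : n ≠ 0 := by omega
  refine ⟨isOpen_thickening hN, closedChamber_subset_thickening hn hk hFN, ?_⟩
  refine ⟨⟨fun p => ⟨slide k (p.1 : ℝ) p.2.1, slide_mem_thickening hn' p.2.2 p.1.2⟩, ?_⟩,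
    fun x => Subtype.ext (slide_zero x.2.1), fun x => slide_one_mem hn' x.2.1,
    fun t x hx => Subtype.ext (slide_of_mem x.2.1 hx _)⟩
  refine Continuous.subtype_mk ?_ _
  exact (continuousOn_slide k).comp_continuous
    (f := fun p : unitInterval × thickening k N => ((p.1 : ℝ), (p.2 : UConf n))) (by fun_prop)
    fun p => ⟨p.1.2, p.2.2.1⟩

theorem slide_joinedIn (hx : x ∈ spread n) {A : Set (UConf n)}
    (hA : ∀ s ∈ Icc (0 : ℝ) 1, slide k s x ∈ A) : JoinedIn A x (slide k 1 x) := by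
  refine JoinedIn.ofLine (f := fun s => slide k s x) ?_ (slide_zero hx) rfl ?_
  · exact (continuousOn_slide k).comp (f := fun s => (s, x)) (by fun_prop) fun s hs => ⟨hs, hx⟩
  · rintro _ ⟨s, hs, rfl⟩; exact hA s hs

theorem isPathConnected_of_slide {A F : Set (UConf n)} (hF : IsPathConnected F) (hFA : F ⊆ A)
    (h : ∀ x ∈ A, x ∈ spread n ∧ (∀ s ∈ Icc (0 : ℝ) 1, slide k s x ∈ A) ∧ slide k 1 x ∈ F) :
    IsPathConnected A := by
  refine isPathConnected_iff.2 ⟨hF.nonempty.mono hFA, fun x hx y hy => ?_⟩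
  obtain ⟨hx1, hx2, hx3⟩ := h x hx
  obtain ⟨hy1, hy2, hy3⟩ := h y hy
  exact (slide_joinedIn hx1 hx2).trans
    (((hF.joinedIn _ hx3 _ hy3).mono hFA).trans (slide_joinedIn hy1 hy2).symm)

theorem isPathConnected_thickening (hn : 2 ≤ n) (hk : 0 ≤ k) (hFN : closedChamber n k ⊆ N) :
    IsPathConnected (thickening k N) :=
  isPathConnected_of_slide (k := k) (isPathConnected_closedChamber hn hk)
    (closedChamber_subset_thickening hn hk hFN) fun _ hx =>
      ⟨hx.1, fun _ hs => slide_mem_thickening (by omega) hx hs, slide_one_mem (by omega) hx.1⟩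

theorem isPathConnected_thickening_inter (hn : 2 ≤ n) (hk : 0 ≤ k) (hFN : closedChamber n k ⊆ N) :
    IsPathConnected (thickening k N ∩ (chamber n k)ᶜ) :=
  isPathConnected_of_slide (k := k) (isPathConnected_boundary hn hk)
    (inter_subset_inter_left _ (closedChamber_subset_thickening hn hk hFN)) fun _ hx =>
      ⟨hx.1.1, fun _ hs => ⟨slide_mem_thickening (by omega) hx.1 hs,
        slide_notMem_chamber (by omega) hx.1.1 hx.2 hs⟩, slide_one_mem (by omega) hx.1.1,
        slide_notMem_chamber (by omega) hx.1.1 hx.2 (by simp)⟩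

end

end UConf

/-! ### The dihedral action and its chambers -/

namespace UConf

open Topology Set

variable {n : ℕ}

/-- The angle between adjacent mirrors of the second central moment. -/
noncomputable def sectorAngle (n : ℕ) : ℝ := Real.pi / (2 * n)

/-- The generating rotation factor. -/
noncomputable def zeta (n : ℕ) : ℂ := Complex.exp (Real.pi * Complex.I / (2 * n))

theorem zeta_ne_zero : zeta n ≠ 0 := Complex.exp_ne_zero _

theorem zeta_zpow (j : ℤ) : zeta n ^ j = Complex.exp ((j * sectorAngle n : ℝ) * Complex.I) := by
  rw [zeta, ← Complex.exp_int_mul, sectorAngle]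
  congr 1
  push_cast
  ring

theorem conj_zeta_zpow (j : ℤ) : (starRingEnd ℂ) (zeta n ^ j) = zeta n ^ (-j) := by
  rw [zeta_zpow, zeta_zpow, ← Complex.exp_conj]
  congr 1
  simp

theorem zeta_zpow_two_mul (hn : n ≠ 0) : zeta n ^ (2 * n : ℤ) = -1 := by
  rw [zeta_zpow, sectorAngle, ← Complex.exp_pi_mul_I]
  congr 2
  norm_cast
  push_cast
  field_simp

/-- Rotate a labelled configuration. -/
noncomputable def rot (j : ℤ) (z : OConf n) : OConf n :=
  ⟨fun i => zeta n ^ j * z.1 i, fun _ _ h =>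
    z.2 (mul_left_cancel₀ (zpow_ne_zero j zeta_ne_zero) h)⟩

/-- Reflect a labelled configuration in the real line. -/
noncomputable def refl (z : OConf n) : OConf n :=
  ⟨fun i => (starRingEnd ℂ) (z.1 i), fun _ _ h => z.2 ((starRingEnd ℂ).injective h)⟩

theorem rot_rot (j k : ℤ) (z : OConf n) : rot j (rot k z) = rot (j + k) z := by
  refine Subtype.ext (funext fun i => ?_)
  simp only [rot, zpow_add₀ (zeta_ne_zero (n := n)), mul_assoc]

theorem rot_zero (z : OConf n) : rot 0 z = z :=
  Subtype.ext (funext fun i => by simp [rot])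

theorem refl_rot (j : ℤ) (z : OConf n) : refl (rot j z) = rot (-j) (refl z) := by
  refine Subtype.ext (funext fun i => ?_)
  simp only [rot, refl, map_mul, conj_zeta_zpow]

theorem refl_refl (z : OConf n) : refl (refl z) = z :=
  Subtype.ext (funext fun i => by simp [refl])

theorem rotation_mk (z : OConf n) : rotation n (mk z) = mk (rot 1 z) := by
  change mk _ = mk _
  congr 1
  exact Subtype.ext (funext fun i => by simp [rot, zeta])

theorem reflection_mk (z : OConf n) : reflection n (mk z) = mk (refl z) := rfl

theorem rotation_zpow_mk (j : ℤ) (z : OConf n) : (rotation n ^ j) (mk z) = mk (rot j z) := by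
  have hpow : ∀ (m : ℕ) (z : OConf n), (rotation n ^ m) (mk z) = mk (rot m z) := by
    intro m
    induction m with
    | zero => intro z; rw [pow_zero, Nat.cast_zero, rot_zero]; rfl
    | succ m ih =>
      intro z
      rw [pow_succ]
      change (rotation n ^ m) (rotation n (mk z)) = _
      rw [rotation_mk, ih, rot_rot]
      push_cast
      rfl
  obtain ⟨m, rfl | rfl⟩ := j.eq_nat_or_neg
  · rw [zpow_natCast, hpow]
  · rw [zpow_neg, zpow_natCast]
    have h := hpow m (rot (-m) z)
    rw [rot_rot, add_neg_cancel, rot_zero] at h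
    exact (rotation n ^ m).injective (((rotation n ^ m).apply_symm_apply (mk z)).trans h.symm)

theorem rotation_zpow_mem (j : ℤ) : rotation n ^ j ∈ dihedral n :=
  zpow_mem (Subgroup.subset_closure (by simp)) j

theorem reflection_mem : reflection n ∈ dihedral n := Subgroup.subset_closure (by simp)

/-- The elements of the dihedral group are rotations and reflections. -/
theorem dihedral_cases {g : UConf n ≃ₜ UConf n} (hg : g ∈ dihedral n) :
    ∃ j : ℤ, (∀ z, g (mk z) = mk (rot j z)) ∨ ∀ z, g (mk z) = mk (rot j (refl z)) := by
  induction hg using Subgroup.closure_induction with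
  | mem g h =>
    rcases h with rfl | rfl
    · exact ⟨1, .inl rotation_mk⟩
    · exact ⟨0, .inr fun z => by rw [rot_zero, reflection_mk]⟩
  | one => exact ⟨0, .inl fun z => by rw [rot_zero]; rfl⟩
  | mul g h _ _ hg hh =>
    obtain ⟨j, hg⟩ := hg
    obtain ⟨k, hh⟩ := hh
    have e : ∀ z, (g * h) (mk z) = g (h (mk z)) := fun z => rfl
    rcases hg with hg | hg <;> rcases hh with hh | hh
    · exact ⟨j + k, .inl fun z => by rw [e, hh, hg, rot_rot]⟩
    · exact ⟨j + k, .inr fun z => by rw [e, hh, hg, rot_rot]⟩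
    · exact ⟨j + -k, .inr fun z => by rw [e, hh, hg, refl_rot, rot_rot]⟩
    · exact ⟨j + -k, .inl fun z => by rw [e, hh, hg, refl_rot, rot_rot, refl_refl]⟩
  | inv g _ hg =>
    obtain ⟨j, hg⟩ := hg
    have e : ∀ z, g (g⁻¹ (mk z)) = mk z := fun z => g.apply_symm_apply (mk z)
    rcases hg with hg | hg
    · refine ⟨-j, .inl fun z => g.injective ?_⟩
      rw [e, hg, rot_rot, add_neg_cancel, rot_zero]
    · refine ⟨j, .inr fun z => g.injective ?_⟩
      rw [e, hg, refl_rot, rot_rot, add_neg_cancel, rot_zero, refl_refl]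

theorem rot_emod (hn : n ≠ 0) (j : ℤ) (z : OConf n) : rot (j % (4 * n : ℕ)) z = rot j z := by
  have h4 : zeta n ^ ((4 * n : ℕ) : ℤ) = 1 := by
    have : ((4 * n : ℕ) : ℤ) = 2 * n + 2 * n := by push_cast; ring
    rw [this, zpow_add₀ zeta_ne_zero, zeta_zpow_two_mul hn]
    norm_num
  refine Subtype.ext (funext fun i => ?_)
  simp only [rot]
  congr 1
  conv_rhs => rw [← Int.emod_add_mul_ediv j (4 * n : ℕ), zpow_add₀ zeta_ne_zero, zpow_mul, h4,
    one_zpow, mul_one]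

/-- Exponents matter only modulo `4 * n`. Finiteness makes the union of the other closed chambers
closed. -/
theorem finite_dihedral (hn : n ≠ 0) : (dihedral n : Set (UConf n ≃ₜ UConf n)).Finite := by
  have hsub : (dihedral n : Set (UConf n ≃ₜ UConf n)) ⊆ ⋃ j ∈ Finset.range (4 * n),
      ({g | ∀ z, g (mk z) = mk (rot j z)} ∪ {g | ∀ z, g (mk z) = mk (rot j (refl z))}) := by
    intro g hg
    obtain ⟨j, hj⟩ := dihedral_cases hg
    have h4 : (0 : ℤ) < (4 * n : ℕ) := by positivity
    have hnn := Int.emod_nonneg j h4.ne'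
    have hlt := Int.emod_lt_of_pos j h4
    have hc : (((j % (4 * n : ℕ)).toNat : ℕ) : ℤ) = j % (4 * n : ℕ) := Int.toNat_of_nonneg hnn
    refine mem_iUnion₂.2 ⟨(j % (4 * n : ℕ)).toNat, Finset.mem_range.2 (by omega), ?_⟩
    simp only [hc, rot_emod hn]
    exact hj
  refine Set.Finite.subset (Set.Finite.biUnion (Finset.finite_toSet _) fun j _ => ?_) hsub
  have hext : ∀ g h : UConf n ≃ₜ UConf n, (∀ z, g (mk z) = h (mk z)) → g = h := fun g h e =>
    Homeomorph.ext fun x => by obtain ⟨z, rfl⟩ := mk_surjective x; exact e z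
  refine Set.Finite.union (Set.Subsingleton.finite ?_) (Set.Subsingleton.finite ?_)
  · exact fun g hg h hh => hext g h fun z => (hg z).trans (hh z).symm
  · exact fun g hg h hh => hext g h fun z => (hg z).trans (hh z).symm

/-- The second central moment of a labelled configuration. -/
noncomputable def qmom (z : OConf n) : ℂ := ∑ i, (z.1 i - mean z.1) ^ 2

theorem mean_rot (j : ℤ) (z : OConf n) : mean (rot j z).1 = zeta n ^ j * mean z.1 := by
  simp only [mean, rot, ← Finset.mul_sum, mul_div_assoc]

theorem mean_refl (z : OConf n) : mean (refl z).1 = (starRingEnd ℂ) (mean z.1) := by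
  simp [mean, refl]

theorem qmom_rot (j : ℤ) (z : OConf n) : qmom (rot j z) = zeta n ^ (2 * j) * qmom z := by
  have : zeta n ^ (2 * j) = zeta n ^ j * zeta n ^ j := by
    rw [← zpow_add₀ zeta_ne_zero, two_mul]
  rw [qmom, mean_rot, qmom, Finset.mul_sum, this]
  exact Finset.sum_congr rfl fun i _ => by simp only [rot]; ring

theorem qmom_refl (z : OConf n) : qmom (refl z) = (starRingEnd ℂ) (qmom z) := by
  rw [qmom, mean_refl, qmom, map_sum]
  exact Finset.sum_congr rfl fun i _ => by simp [refl]

theorem qmom_eq (z : OConf n) :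
    (qmom z).re = momRe (mk z) - momIm (mk z) ∧ (qmom z).im = 2 * momMix (mk z) := by
  rw [qmom, Complex.re_sum, Complex.im_sum, momRe_mk, momIm_mk, momMix_mk, Finset.mul_sum,
    ← Finset.sum_sub_distrib]
  constructor <;> refine Finset.sum_congr rfl fun i _ => ?_
  · simp only [pow_two, Complex.mul_re, Complex.sub_re, Complex.sub_im, relRe, relIm]
  · simp only [pow_two, Complex.mul_im, Complex.sub_re, Complex.sub_im, relRe, relIm]; ring

/-- The slope bounding the chamber. -/
noncomputable def slope (n : ℕ) : ℝ := Real.cos (sectorAngle n) / Real.sin (sectorAngle n)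

theorem sectorAngle_pos (hn : 2 ≤ n) : 0 < sectorAngle n := by
  have : (0 : ℝ) < n := by positivity
  exact div_pos Real.pi_pos (by linarith)

theorem sectorAngle_le (hn : 2 ≤ n) : sectorAngle n ≤ Real.pi / 4 := by
  have : (2 : ℝ) ≤ n := by exact_mod_cast hn
  exact div_le_div_of_nonneg_left Real.pi_pos.le (by norm_num) (by linarith)

theorem sin_sectorAngle_pos (hn : 2 ≤ n) : 0 < Real.sin (sectorAngle n) :=
  Real.sin_pos_of_pos_of_lt_pi (sectorAngle_pos hn)
    (by linarith [sectorAngle_le hn, Real.pi_pos])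

theorem slope_nonneg (hn : 2 ≤ n) : 0 ≤ slope n :=
  div_nonneg (Real.cos_nonneg_of_neg_pi_div_two_le_of_le
    (by linarith [sectorAngle_pos hn, Real.pi_pos])
    (by linarith [sectorAngle_le hn, Real.pi_pos])) (sin_sectorAngle_pos hn).le

theorem mk_mem_chamber_iff (z : OConf n) (k : ℝ) : mk z ∈ chamber n k ↔
    0 < (qmom z).im ∧ 0 < (qmom z).re - k * (qmom z).im ∧ 0 < (mean z.1).im := by
  obtain ⟨h1, h2⟩ := qmom_eq z
  rw [h1, h2, ← height_mk]
  refine and_congr ?_ (and_congr ?_ Iff.rfl)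
  · constructor <;> intro h <;> linarith
  · constructor <;> intro h <;> linarith

theorem mk_mem_closedChamber_iff (z : OConf n) (k : ℝ) : mk z ∈ closedChamber n k ↔
    0 ≤ (qmom z).im ∧ 0 ≤ (qmom z).re - k * (qmom z).im ∧ 0 ≤ (mean z.1).im := by
  obtain ⟨h1, h2⟩ := qmom_eq z
  rw [h1, h2, ← height_mk]
  refine and_congr ?_ (and_congr ?_ Iff.rfl)
  · constructor <;> intro h <;> linarith
  · constructor <;> intro h <;> linarith

/-- The linear form bounding the sector, in polar coordinates. -/
theorem re_sub_slope_mul_im (hn : 2 ≤ n) (R a : ℝ) :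
    ((R * Complex.exp (a * Complex.I) : ℂ)).re - slope n * ((R * Complex.exp (a * Complex.I) : ℂ)).im
      = R * Real.sin (sectorAngle n - a) / Real.sin (sectorAngle n) := by
  have := (sin_sectorAngle_pos hn).ne'
  rw [Complex.re_ofReal_mul, Complex.im_ofReal_mul, Complex.exp_ofReal_mul_I_re,
    Complex.exp_ofReal_mul_I_im, slope, Real.sin_sub]
  field_simp

theorem arg_qmom_mem (hn : 2 ≤ n) {z : OConf n} (h : mk z ∈ chamber n (slope n)) :
    0 < (qmom z).arg ∧ (qmom z).arg < sectorAngle n := by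
  obtain ⟨h1, h2, -⟩ := (mk_mem_chamber_iff z _).1 h
  have hq : qmom z ≠ 0 := fun h0 => by rw [h0] at h1; simp at h1
  have hR : 0 < ‖qmom z‖ := norm_pos_iff.2 hq
  have hp : (‖qmom z‖ : ℂ) * Complex.exp ((qmom z).arg * Complex.I) = qmom z :=
    Complex.norm_mul_exp_arg_mul_I _
  have ha0 : 0 < (qmom z).arg := by
    refine lt_of_le_of_ne (Complex.arg_nonneg_iff.2 h1.le) fun h0 => ?_
    exact h1.ne' (Complex.arg_eq_zero_iff.1 h0.symm).2
  refine ⟨ha0, ?_⟩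
  rw [← hp, re_sub_slope_mul_im hn] at h2
  by_contra! hc
  have := Real.sin_nonpos_of_nonpos_of_neg_pi_le (x := sectorAngle n - (qmom z).arg) (by linarith)
    (by linarith [Complex.arg_le_pi (qmom z), sectorAngle_pos hn])
  have : ‖qmom z‖ * Real.sin (sectorAngle n - (qmom z).arg) / Real.sin (sectorAngle n) ≤ 0 :=
    div_nonpos_of_nonpos_of_nonneg (mul_nonpos_of_nonneg_of_nonpos hR.le this)
      (sin_sectorAngle_pos hn).le
  linarith

/-- Equality of directions, in terms of multiples of the sector angle. -/
theorem exists_int_of_exp_eq (hn : 2 ≤ n) {a b : ℝ} (j : ℤ)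
    (h : Complex.exp (a * Complex.I) = zeta n ^ (2 * j) * Complex.exp (b * Complex.I)) :
    ∃ m : ℤ, a = b + 2 * (j + 2 * n * m) * sectorAngle n := by
  rw [zeta_zpow, ← Complex.exp_add, Complex.exp_eq_exp_iff_exists_int] at h
  obtain ⟨m, hm⟩ := h
  refine ⟨m, ?_⟩
  have h' := congrArg Complex.im hm
  simp only [Complex.add_im, Complex.mul_im, Complex.ofReal_re, Complex.ofReal_im, Complex.I_re,
    Complex.I_im, Complex.intCast_re, Complex.intCast_im, Complex.mul_re] at h'
  norm_num at h'
  have hπ : 2 * (n : ℝ) * sectorAngle n = Real.pi := by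
    have : (n : ℝ) ≠ 0 := by positivity
    rw [sectorAngle]; field_simp
  rw [h', ← hπ]
  ring

/-- Write θ for the sector angle. A rotation changes the argument of `qmom` by an even multiple of
θ; both arguments lie strictly between 0 and θ, so that multiple is 0 and the rotation factor is ±1,
with -1 excluded by the height. A reflection would make the sum of the two arguments an even
multiple of θ strictly between 0 and 2θ. -/
theorem eq_one_of_mem_chamber (hn : 2 ≤ n) {g : UConf n ≃ₜ UConf n} (hg : g ∈ dihedral n)
    {x : UConf n} (hx : x ∈ chamber n (slope n)) (hgx : g x ∈ chamber n (slope n)) : g = 1 := by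
  obtain ⟨z, rfl⟩ := mk_surjective x
  have hθ := sectorAngle_pos hn
  obtain ⟨hb0, hb1⟩ := arg_qmom_mem hn hx
  have hq0 : qmom z ≠ 0 := fun h => by simp [h] at hb0
  have hpz : (‖qmom z‖ : ℂ) * Complex.exp ((qmom z).arg * Complex.I) = qmom z :=
    Complex.norm_mul_exp_arg_mul_I _
  have hz2 : ∀ j : ℤ, ‖zeta n ^ j‖ = 1 := fun j => by
    rw [zeta_zpow, Complex.norm_exp_ofReal_mul_I]
  have hRC : (‖qmom z‖ : ℂ) ≠ 0 := by exact_mod_cast norm_ne_zero_iff.2 hq0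
  obtain ⟨j, hj | hj⟩ := dihedral_cases hg
  · rw [hj z] at hgx
    obtain ⟨ha0, ha1⟩ := arg_qmom_mem hn hgx
    have hpw : (‖qmom (rot j z)‖ : ℂ) * Complex.exp ((qmom (rot j z)).arg * Complex.I) =
      qmom (rot j z) := Complex.norm_mul_exp_arg_mul_I _
    have hnorm : ‖qmom (rot j z)‖ = ‖qmom z‖ := by rw [qmom_rot, norm_mul, hz2, one_mul]
    have hexp : Complex.exp ((qmom (rot j z)).arg * Complex.I) =
        zeta n ^ (2 * j) * Complex.exp ((qmom z).arg * Complex.I) := by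
      refine mul_left_cancel₀ hRC ?_
      rw [← hnorm, hpw, mul_left_comm, hnorm, hpz, qmom_rot]
    obtain ⟨m, hm⟩ := exists_int_of_exp_eq hn j hexp
    have hjm : j + 2 * n * m = 0 := by
      have h1 : -1 < j + 2 * n * m := by
        have : (-1 : ℝ) < ((j + 2 * n * m : ℤ) : ℝ) := by
          push_cast
          by_contra! hc
          nlinarith
        exact_mod_cast this
      have h2 : j + 2 * n * m < 1 := by
        have : ((j + 2 * n * m : ℤ) : ℝ) < 1 := by
          push_cast
          by_contra! hc
          nlinarith
        exact_mod_cast this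
      omega
    -- Here `j = -2nm`, so the square is an even power of `zeta n ^ (2 * n) = -1`.
    have hsq : (zeta n ^ j) ^ 2 = 1 := by
      rw [← zpow_natCast, ← zpow_mul, show j * ((2 : ℕ) : ℤ) = (2 * n) * (2 * -m) by
        push_cast; linear_combination 2 * hjm, zpow_mul, zeta_zpow_two_mul (by omega), zpow_mul]
      norm_num
    have hone : zeta n ^ j = 1 := by
      rcases eq_or_eq_neg_of_sq_eq_sq _ _ (hsq.trans (one_pow 2).symm) with h | h
      · exact h
      · have h1 := ((mk_mem_chamber_iff _ _).1 hx).2.2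
        have h2 := ((mk_mem_chamber_iff _ _).1 hgx).2.2
        rw [mean_rot, h, neg_one_mul, Complex.neg_im] at h2
        linarith
    refine Homeomorph.ext fun y => ?_
    obtain ⟨w, rfl⟩ := mk_surjective y
    rw [hj w]
    change mk _ = mk w
    congr 1
    exact Subtype.ext (funext fun i => by simp [rot, hone])
  · rw [hj z] at hgx
    obtain ⟨ha0, ha1⟩ := arg_qmom_mem hn hgx
    have hpw : (‖qmom (rot j (refl z))‖ : ℂ) *
        Complex.exp ((qmom (rot j (refl z))).arg * Complex.I) =
      qmom (rot j (refl z)) := Complex.norm_mul_exp_arg_mul_I _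
    have hnorm : ‖qmom (rot j (refl z))‖ = ‖qmom z‖ := by
      rw [qmom_rot, norm_mul, hz2, one_mul, qmom_refl, Complex.norm_conj]
    have hpz' : (‖qmom z‖ : ℂ) * Complex.exp ((-(qmom z).arg : ℝ) * Complex.I) =
        qmom (refl z) := by
      rw [qmom_refl, ← hpz, map_mul, Complex.conj_ofReal, ← Complex.exp_conj, hpz]
      simp
    have hexp : Complex.exp ((qmom (rot j (refl z))).arg * Complex.I) =
        zeta n ^ (2 * j) * Complex.exp ((-(qmom z).arg : ℝ) * Complex.I) := by
      refine mul_left_cancel₀ hRC ?_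
      rw [← hnorm, hpw, mul_left_comm, hnorm, hpz', qmom_rot]
    obtain ⟨m, hm⟩ := exists_int_of_exp_eq hn j hexp
    exfalso
    have h1 : 0 < j + 2 * n * m := by
      have : (0 : ℝ) < ((j + 2 * n * m : ℤ) : ℝ) := by
        push_cast
        by_contra! hc
        nlinarith
      exact_mod_cast this
    have h2 : j + 2 * n * m < 1 := by
      have : ((j + 2 * n * m : ℤ) : ℝ) < 1 := by
        push_cast
        by_contra! hc
        nlinarith
      exact_mod_cast this
    omega

/-- Every configuration can be moved into the closed chamber. -/
theorem exists_mem_closedChamber (hn : 2 ≤ n) (x : UConf n) :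
    ∃ g ∈ dihedral n, g x ∈ closedChamber n (slope n) := by
  obtain ⟨z, rfl⟩ := mk_surjective x
  have hθ := sectorAngle_pos hn
  have hsec : ∃ g ∈ dihedral n, ∃ w : OConf n, g (mk z) = mk w ∧ ∃ R a : ℝ, 0 ≤ R ∧ 0 ≤ a ∧
      a ≤ sectorAngle n ∧ qmom w = R * Complex.exp (a * Complex.I) := by
    -- Rotations shift the argument in steps of twice the sector angle, so rounding brings it within
    -- one sector angle of 0; a reflection then makes it nonnegative.
    set c : ℝ := (qmom z).arg / (2 * sectorAngle n) with hc
    set j : ℤ := -round c with hj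
    set a : ℝ := (2 * j : ℤ) * sectorAngle n + (qmom z).arg with ha
    have harg : (qmom z).arg = c * (2 * sectorAngle n) := by rw [hc]; field_simp
    have ha' : a = (c - round c) * (2 * sectorAngle n) := by
      rw [ha, harg, hj]; push_cast; ring
    have habs : |a| ≤ sectorAngle n := by
      rw [ha', abs_mul, abs_of_pos (by linarith : 0 < 2 * sectorAngle n)]
      nlinarith [abs_sub_round c]
    obtain ⟨hl, hu⟩ := abs_le.1 habs
    have hq : qmom (rot j z) = ‖qmom z‖ * Complex.exp (a * Complex.I) := by
      rw [qmom_rot, zeta_zpow, ha]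
      conv_lhs => rw [← Complex.norm_mul_exp_arg_mul_I (qmom z)]
      rw [mul_left_comm, ← Complex.exp_add]
      congr 2
      push_cast
      ring
    rcases le_total 0 a with h0 | h0
    · exact ⟨_, rotation_zpow_mem j, _, rotation_zpow_mk j z, ‖qmom z‖, a, norm_nonneg _, h0, hu, hq⟩
    · refine ⟨reflection n * rotation n ^ j, mul_mem reflection_mem (rotation_zpow_mem j),
        refl (rot j z), ?_, ‖qmom z‖, -a, norm_nonneg _, by linarith, by linarith, ?_⟩
      · change reflection n ((rotation n ^ j) (mk z)) = _
        rw [rotation_zpow_mk, reflection_mk]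
      · rw [qmom_refl, hq, map_mul, Complex.conj_ofReal, ← Complex.exp_conj]
        simp
  obtain ⟨g, hg, w, hgw, R, a, hR, ha0, ha1, hq⟩ := hsec
  have hs : ∀ v : OConf n, qmom v = qmom w → 0 ≤ (mean v.1).im →
      mk v ∈ closedChamber n (slope n) := by
    intro v hv hm
    rw [mk_mem_closedChamber_iff, hv, hq, re_sub_slope_mul_im hn, Complex.im_ofReal_mul,
      Complex.exp_ofReal_mul_I_im]
    have hπ := sectorAngle_le hn
    have := Real.pi_pos
    refine ⟨mul_nonneg hR (Real.sin_nonneg_of_nonneg_of_le_pi ha0 (by linarith)), ?_, hm⟩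
    exact div_nonneg (mul_nonneg hR
      (Real.sin_nonneg_of_nonneg_of_le_pi (by linarith) (by linarith)))
      (sin_sectorAngle_pos hn).le
  rcases le_total 0 (mean w.1).im with h0 | h0
  · exact ⟨g, hg, by rw [hgw]; exact hs w rfl h0⟩
  · refine ⟨rotation n ^ (2 * n : ℤ) * g, mul_mem (rotation_zpow_mem _) hg, ?_⟩
    change (rotation n ^ (2 * n : ℤ)) (g (mk z)) ∈ _
    rw [hgw, rotation_zpow_mk]
    have h1 := zeta_zpow_two_mul (n := n) (by omega)
    refine hs _ ?_ ?_
    · rw [qmom_rot, mul_comm 2, zpow_mul, h1]; norm_num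
    · rw [mean_rot, h1, neg_one_mul, Complex.neg_im]; linarith

theorem isChamber_chamber (hn : 2 ≤ n) : IsChamber (dihedral n) (chamber n (slope n)) where
  isOpen := isOpen_chamber _
  isConnected := (isPathConnected_chamber hn (slope_nonneg hn)).isConnected
  disjoint g hg h hh hne := by
    rw [Set.disjoint_left]
    rintro _ ⟨x, hx, rfl⟩ ⟨y, hy, he⟩
    refine hne ?_
    have : g⁻¹ * h = 1 := by
      refine eq_one_of_mem_chamber hn (mul_mem (inv_mem hg) hh) hy ?_
      have e : (g⁻¹ * h) y = x := by
        change g.symm (h y) = x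
        rw [he]
        exact g.symm_apply_apply x
      rwa [e]
    exact inv_mul_eq_one.1 this
  cover := by
    refine eq_univ_of_forall fun x => ?_
    obtain ⟨g, hg, hx⟩ := exists_mem_closedChamber hn x
    refine mem_iUnion₂.2 ⟨g⁻¹, inv_mem hg, ?_⟩
    rw [← Homeomorph.image_closure, closure_chamber hn (slope_nonneg hn)]
    exact ⟨g x, hx, g.symm_apply_apply x⟩

/-- The open chamber misses its translates, hence their closures. Conversely, the other closed
chambers cover everything outside the closed chamber; being a finite union they form a closed set,
which then contains the boundary points as limits of outside points. -/
theorem otherChambers_chamber (hn : 2 ≤ n) :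
    otherChambers (dihedral n) (chamber n (slope n)) = (chamber n (slope n))ᶜ := by
  have hC := isChamber_chamber hn
  have hcl := closure_chamber hn (slope_nonneg hn)
  refine subset_antisymm ?_ ?_
  · refine iUnion₂_subset fun g hg => iUnion_subset fun hne => ?_
    have hd := hC.disjoint 1 (one_mem _) g hg hne.symm
    have e : ((1 : UConf n ≃ₜ UConf n) '' chamber n (slope n)) = chamber n (slope n) :=
      image_id _
    rw [e] at hd
    exact (hd.closure_right hC.isOpen).subset_compl_left
  · have hout : (closedChamber n (slope n))ᶜ ⊆
        otherChambers (dihedral n) (chamber n (slope n)) := by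
      intro x hx
      obtain ⟨g, hg, hxg⟩ := mem_iUnion₂.1 (hC.cover.symm ▸ mem_univ x : x ∈ ⋃ g ∈ dihedral n,
        closure (g '' chamber n (slope n)))
      refine mem_iUnion₂.2 ⟨g, hg, mem_iUnion.2 ⟨?_, hxg⟩⟩
      rintro rfl
      have e : ((1 : UConf n ≃ₜ UConf n) '' chamber n (slope n)) = chamber n (slope n) :=
        image_id _
      rw [e, hcl] at hxg
      exact hx hxg
    have hclosed : IsClosed (otherChambers (dihedral n) (chamber n (slope n))) := by
      refine Set.Finite.isClosed_biUnion (finite_dihedral (by omega)) fun g _ => ?_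
      by_cases h : g ≠ 1
      · simp [h]
      · simp [h]
    intro x hx
    by_cases h : x ∈ closedChamber n (slope n)
    · exact closure_minimal hout hclosed (boundary_subset hn (slope_nonneg hn) ⟨h, hx⟩)
    · exact hout h

end UConf

/-! ### The main theorem -/

theorem mainTheorem4 (n : ℕ) (hn : 2 ≤ n) :
    ∃ C X₂ : Set (UConf n),
      IsChamber (UConf.dihedral n) C ∧ UConf.realPoints n ⊆ closure C ∧
      X₂ = otherChambers (UConf.dihedral n) C ∧
      ∀ N : Set (UConf n), IsOpen N → closure C ⊆ N →
        ∃ X₁ ⊆ N, IsThickening (closure C) X₁ ∧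
          UConf.realPoints n ⊆ X₁ ∩ X₂ ∧ (X₁ ∩ X₂).Nonempty ∧
          interior X₁ ∪ interior X₂ = Set.univ ∧
          ∀ B ⊆ UConf.realPoints n,
            (∀ a ∈ UConf.realPoints n, ∃ b ∈ B, JoinedIn (UConf.realPoints n) a b) →
            VanKampenIso X₁ X₂ B := by
  have hk := UConf.slope_nonneg hn
  refine ⟨UConf.chamber n (UConf.slope n), _, UConf.isChamber_chamber hn, ?_, rfl, ?_⟩
  · rw [UConf.closure_chamber hn hk]
    exact UConf.realPoints_subset_closedChamber _
  intro N hN hFN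
  rw [UConf.closure_chamber hn hk] at hFN ⊢
  rw [UConf.otherChambers_chamber hn]
  have hFX := UConf.closedChamber_subset_thickening hn hk hFN
  have hreal : UConf.realPoints n ⊆
      UConf.thickening (UConf.slope n) N ∩ (UConf.chamber n (UConf.slope n))ᶜ := fun x hx =>
    ⟨hFX (UConf.realPoints_subset_closedChamber _ hx), UConf.realPoints_subset_compl_chamber _ hx⟩
  have hcov : interior (UConf.thickening (UConf.slope n) N) ∪
      interior (UConf.chamber n (UConf.slope n))ᶜ = Set.univ := by
    refine Set.eq_univ_of_forall fun x => ?_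
    by_cases hx : x ∈ UConf.closedChamber n (UConf.slope n)
    · left
      rw [(UConf.isOpen_thickening hN).interior_eq]
      exact hFX hx
    · right
      exact interior_maximal (Set.compl_subset_compl.2 (UConf.chamber_subset _))
        (UConf.isClosed_closedChamber _).isOpen_compl hx
  refine ⟨_, UConf.thickening_subset, UConf.isThickening hn hk hN hFN, hreal,
    UConf.realPoints_nonempty.mono hreal, hcov, fun B hB hBr => ?_⟩
  obtain ⟨a, ha⟩ := UConf.realPoints_nonempty (n := n)
  -- The condition on path components is needed only to make `B` nonempty, since both pieces and
  -- their intersection are path connected.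
  obtain ⟨b, hb, -⟩ := hBr a ha
  exact vanKampenIso hcov (UConf.isPathConnected_thickening hn hk hFN)
    (UConf.isPathConnected_compl_chamber (by omega))
    (UConf.isPathConnected_thickening_inter hn hk hFN) (hB.trans hreal) ⟨b, hb⟩
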